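/- **Setting.** Predicates have positive arities; an atom is $R(t_1,\dots,t_n)$ with $n$ the arity of $R$; a database $D$ is a finite set of atoms over constants; an instance is a set of atoms over constants and nulls. A TGD $\sigma$ is $\varphi(\bar x,\bar y)\to\exists\bar z\,\psi(\bar x,\bar z)$ with non-empty conjunctions of constant-free atoms as body and head; its frontier $\mathrm{fr}(\sigma)$ is the set of variables occurring in both body and head. It is guarded if some body atom contains all body variables; the leftmost such atom is its guard. Throughout, $\Sigma$ is a finite set of guarded TGDs no two of which share a variable. Write $\mathrm{sch}(\Sigma)$ for the set of predicates occurring in $\Sigma$, $\mathrm{ar}(\Sigma)$ for their maximal arity ($0$ if $\Sigma=\emptyset$), and $\mathrm{atoms}(\Sigma)$ for the set of atoms occurring in $\Sigma$. **Chase.** A trigger on an instance $I$ is a pair $(\sigma,h)$ with $\sigma\in\Sigma$ and $h$ a homomorphism from the body of $\sigma$ to $I$; $\mathrm{result}(\sigma,h)$ is the head of $\sigma$ with each frontier variable $x$ replaced by $h(x)$ and each existential variable $z$ by a null $\bot^{z}_{\sigma,h|_{\mathrm{fr}(\sigma)}}$ (distinct names for distinct indices). It is active if $\mathrm{result}(\sigma,h)\not\subseteq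 I$. A valid chase derivation of $D$ starts with $D$, at each step adds the result of an active trigger, and either ends after finitely many steps with no active trigger, or is infinite and fair (each trigger active at some stage is not active at some later stage). All valid derivations have the same result (the last instance, respectively the union), called $\mathrm{chase}(D,\Sigma)$. **Weak acyclicity.** The dependency graph of a set of TGDs has the positions $(R,i)$ as nodes; for each TGD $\sigma$, each $x\in\mathrm{fr}(\sigma)$ and each position $\pi$ of $x$ in the body there is a normal edge from $\pi$ to each position of $x$ in the head, and a special edge from $\pi$ to each position of an existential variable in the head. $P$ is reachable from $R$ if it is obtained from $R$ by finitely many (possibly zero) steps from a body predicate to a head predicate of a TGD. The set is $D$-weakly-acyclic if there is no (not necessarily simple) cycle in the graph that contains a special edge and a node $(P,i)$ with $P$ reachable from a predicate of an atom of $D$. **Linearization.** A $\Sigma$-type is a pair $\tau=(\alpha,T)$, where $\alpha=R(t_1,\dots,t_n)$ with $R\in\mathrm{sch}(\Sigma)$ and integers $t_1=1$, $1\le t_i\le\max_{j<i}t_j+1$, and $T$ is a set of atoms other than $\alpha$ with predicates from $\mathrm{sch}(\Sigma)$ and arguments among the $t_i$; $\mathrm{atoms}(\tau)=T\cup\{\alpha\}$,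 and $[\tau]$ is a new predicate of the arity of $R$. $\mathsf{lin}(D)$ is the set of the atoms $[\tau](\bar t)$ such that $R(\bar t)\in D$, $\tau$ is a $\Sigma$-type with guard $R(\bar u)$, $\bar u$ and $\bar t$ have the same equality pattern, and replacing $\bar u$ by $\bar t$ in $\mathrm{atoms}(\tau)$ gives the type of $R(\bar t)$, i.e. the set of all atoms of $\mathrm{chase}(D,\Sigma)$ with predicates from $\mathrm{sch}(\Sigma)$ that mention only terms of $\bar t$. $\mathsf{lin}(\Sigma)$ is the set of all TGDs $[\tau](\bar u)\to\exists\bar z\,[\tau_1](\bar u_1),\dots,[\tau_m](\bar u_m)$, where $\sigma\in\Sigma$ has guard $R(\bar u)$, existential variables $\bar z$ and head $R_1(\bar u_1),\dots,R_m(\bar u_m)$, $\tau$ is a $\Sigma$-type, $h$ is a homomorphism from the body of $\sigma$ to $\mathrm{atoms}(\tau)$ mapping $R(\bar u)$ to the guard of $\tau$, and $\tau_i$ is obtained as follows: let $f$ be $h$ on the frontier and map the existential variables to distinct fresh constants, $\alpha_i=R_i(f(\bar u_i))$, $I=\{\alpha_1,\dots,\alpha_m\}\cup\mathrm{atoms}(\tau)$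 (regarded as a database), and $T_i$ the set of atoms of $\mathrm{chase}(I,\Sigma)$ other than $\alpha_i$ that mention only terms of $\alpha_i$; then $\tau_i$ is $(\alpha_i,T_i)$ with the terms of $\alpha_i$ renamed to $1,2,\dots$ in the order of first occurrence in $\alpha_i$. **Simplification.** For a tuple $\bar t$, $\mathrm{unique}(\bar t)$ keeps only the first occurrence of each term, and $\mathrm{id}(\bar t)$ replaces each $t_i$ by its position in $\mathrm{unique}(\bar t)$. Then $\mathsf{simple}(R(\bar t))=R_{\mathrm{id}(\bar t)}(\mathrm{unique}(\bar t))$, and $\mathsf{simple}$ of a set (or conjunction) of atoms is taken atom by atom. For a set of linear TGDs, $\mathsf{simple}$ is the set of all TGDs $\mathsf{simple}(R(f(\bar x)))\to\exists\bar z\,\mathsf{simple}(\psi(f(\bar y),\bar z))$, where $R(\bar x)\to\exists\bar z\,\psi(\bar y,\bar z)$ is in the set and $f:\bar x\to\bar x$ satisfies $f(x_1)=x_1$ and $f(x_i)\in\{f(x_1),\dots,f(x_{i-1}),x_i\}$. **Theorem.** Let $D$ be a database and $\Sigma$ a finite set of guarded TGDs, no two of which share a variable. With $n=|\mathrm{sch}(\Sigma)|$,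 $m=\mathrm{ar}(\Sigma)$, $a=|\mathrm{atoms}(\Sigma)|$ put $f_{\mathsf G}(\Sigma)=F(a,n,m)$, where $$F(a,n,m)=(d+1)\cdot(a\,n\,m)^{2m(d+1)},\qquad d=n\cdot m^{2m+1}\cdot 2^{\,n\cdot m^{m}}\qquad(0^0=1).$$ The following are equivalent. 1. The semi-oblivious chase of $D$ w.r.t. $\Sigma$ is finite, i.e. (equivalently) every valid chase derivation of $D$ w.r.t. $\Sigma$ is finite, some valid chase derivation of $D$ w.r.t. $\Sigma$ is finite, $\mathrm{chase}(D,\Sigma)$ is finite. 2. $|\mathrm{chase}(D,\Sigma)|\le|D|\cdot f_{\mathsf G}(\Sigma)$. 3. $\mathsf{simple}(\mathsf{lin}(\Sigma))$ is $\mathsf{simple}(\mathsf{lin}(D))$-weakly-acyclic. Moreover $F$ is triple-exponential in the arity and double-exponential in the number of predicates: for each $n$ there is a polynomial $p$ with $F(a,n,m)\le(a+2)^{2^{2^{p(m)}}}$ for all $a,m$, and for each $m$ there is a polynomial $p$ with $F(a,n,m)\le(a+2)^{2^{p(n)}}$ for all $a,n$. -/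

import Mathlib

namespace SOChase

noncomputable section

/-- Relation symbols (predicates), each with a positive arity. -/
structure Signature where
  Pred : Type*
  arity : Pred → ℕ
  arity_pos : ∀ R, 0 < arity R

/-- An atom `R(t₁, …, tₙ)` with `n` the arity of `R` and arguments from `T`. -/
@[ext] structure Atom (S : Signature) (T : Type*) where
  pred : S.Pred
  args : List T
  length_args : args.length = S.arity pred

/-- `h(R(t₁, …, tₙ)) = R(h(t₁), …, h(tₙ))`. -/
def Atom.map {S : Signature} {T T' : Type*} (h : T → T') (a : Atom S T) : Atom S T' where
  pred := a.pred
  args := a.args.map h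
  length_args := by rw [List.length_map]; exact a.length_args

/-- The terms occurring in a set of atoms. -/
def dom {S : Signature} {T : Type*} (I : Set (Atom S T)) : Set T :=
  {t | ∃ a ∈ I, t ∈ a.args}

/-- A tuple-generating dependency `φ(x̄,ȳ) → ∃ z̄ ψ(x̄,z̄)`; `φ` and `ψ` are non-empty conjunctions
of constant-free atoms. -/
structure TGD (S : Signature) (V : Type*) where
  body : List (Atom S V)
  head : List (Atom S V)
  body_ne : body ≠ []
  head_ne : head ≠ []

namespace TGD

variable {S : Signature} {V : Type*}

/-- The variables of the body. -/
def bodyVars (σ : TGD S V) : Set V := dom {a | a ∈ σ.body}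

/-- The variables of the head. -/
def headVars (σ : TGD S V) : Set V := dom {a | a ∈ σ.head}

/-- All variables of the TGD. -/
def vars (σ : TGD S V) : Set V := σ.bodyVars ∪ σ.headVars

/-- The frontier: the variables that occur both in the body and in the head. -/
def frontier (σ : TGD S V) : Set V := σ.bodyVars ∩ σ.headVars

/-- The existentially quantified variables. -/
def exVars (σ : TGD S V) : Set V := σ.headVars \ σ.bodyVars

/-- The atom `a` contains all variables of the body. -/
def Guards (σ : TGD S V) (a : Atom S V) : Prop := ∀ v ∈ σ.bodyVars, v ∈ a.args

/-- `σ` is guarded: some body atom contains all body variables. -/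
def IsGuarded (σ : TGD S V) : Prop := ∃ a ∈ σ.body, σ.Guards a

open Classical in
/-- The guard: the leftmost body atom that contains all body variables, if there is one. -/
def guard? (σ : TGD S V) : Option (Atom S V) := σ.body.find? (fun a => decide (σ.Guards a))

end TGD

section Parameters

variable {S : Signature} {V : Type*}

/-- The set of atoms occurring in the TGDs of `Γ`. -/
def atomsOf (Γ : Set (TGD S V)) : Set (Atom S V) := {a | ∃ σ ∈ Γ, a ∈ σ.body ∨ a ∈ σ.head}

/-- The schema of `Γ`: the predicates occurring in `Γ`. -/
def sch (Γ : Set (TGD S V)) : Set S.Pred := Atom.pred '' atomsOf Γ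

/-- The maximal arity of a predicate of `sch Γ` (`0` if `Γ` is empty). -/
def ar (Γ : Set (TGD S V)) : ℕ := sSup (S.arity '' sch Γ)

/-- `n · m^(2m+1) · 2^(n · m^m)`. -/
def depthBound (n m : ℕ) : ℕ := n * m ^ (2 * m + 1) * 2 ^ (n * m ^ m)

/-- `(d+1) · (a·n·m)^(2m(d+1))` where `d = n · m^(2m+1) · 2^(n · m^m)`. -/
def sizeBound (a n m : ℕ) : ℕ :=
  (depthBound n m + 1) * (a * n * m) ^ (2 * m * (depthBound n m + 1))

/-- The function `f_G`: the value of `sizeBound` at the number of atoms of `Γ`, the number of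
predicates of `Γ`, and the arity of `Γ`. -/
def fG (Γ : Set (TGD S V)) : ℕ := sizeBound (atomsOf Γ).ncard (sch Γ).ncard (ar Γ)

end Parameters

/-! ## The semi-oblivious chase -/

/-- Constants from `C` and labelled nulls. The null `⊥^x_{σ, h|fr(σ)}` is named by the TGD, the
restriction of `h` to the frontier, and the variable. -/
inductive GTerm (S : Signature) (C V : Type*) where
  | const (c : C) : GTerm S C V
  | null (σ : TGD S V) (h : {x // x ∈ σ.frontier} → GTerm S C V) (x : V) : GTerm S C V

section TheChase

variable {S : Signature} {C V : Type*}

open Classical in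
/-- The substitution `μ` applied to the head when `(σ, h)` is applied. -/
def headSubst (σ : TGD S V) (h : V → GTerm S C V) (x : V) : GTerm S C V :=
  if x ∈ σ.frontier then h x else GTerm.null σ (fun y => h y.1) x

/-- `result(σ, h)`. -/
def result (σ : TGD S V) (h : V → GTerm S C V) : Set (Atom S (GTerm S C V)) :=
  {β | ∃ a ∈ σ.head, β = a.map (headSubst σ h)}

/-- `(σ, h)` is a trigger for `Γ` on `I`; only the values of `h` on the body variables matter. -/
def IsTrigger (Γ : Set (TGD S V)) (I : Set (Atom S (GTerm S C V))) (σ : TGD S V)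
    (h : V → GTerm S C V) : Prop :=
  σ ∈ Γ ∧ ∀ a ∈ σ.body, a.map h ∈ I

/-- `(σ, h)` is an active trigger for `Γ` on `I`. -/
def IsActive (Γ : Set (TGD S V)) (I : Set (Atom S (GTerm S C V))) (σ : TGD S V)
    (h : V → GTerm S C V) : Prop :=
  IsTrigger Γ I σ h ∧ ¬ result σ h ⊆ I

/-- `J` results from `I` by the application of an active trigger. -/
def Step (Γ : Set (TGD S V)) (I J : Set (Atom S (GTerm S C V))) : Prop :=
  ∃ σ h, IsActive Γ I σ h ∧ J = I ∪ result σ h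

/-- A set of facts, seen as an instance. -/
def toInstance (V : Type*) (D : Set (Atom S C)) : Set (Atom S (GTerm S C V)) :=
  Atom.map GTerm.const '' D

/-- A valid (i.e., finite, or infinite and fair) chase derivation of `D` w.r.t. `Γ`. -/
inductive ValidDerivation (D : Set (Atom S C)) (Γ : Set (TGD S V)) where
  | finite (n : ℕ) (I : Fin (n + 1) → Set (Atom S (GTerm S C V)))
      (init : I 0 = toInstance V D)
      (step : ∀ i : Fin n, Step Γ (I i.castSucc) (I i.succ))
      (final : ∀ σ h, ¬ IsActive Γ (I (Fin.last n)) σ h)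
  | infinite (I : ℕ → Set (Atom S (GTerm S C V)))
      (init : I 0 = toInstance V D)
      (step : ∀ i, Step Γ (I i) (I (i + 1)))
      (fair : ∀ i σ h, IsActive Γ (I i) σ h → ∃ j > i, ¬ IsActive Γ (I j) σ h)

namespace ValidDerivation

variable {D : Set (Atom S C)} {Γ : Set (TGD S V)}

/-- The derivation is finite. -/
def IsFinite : ValidDerivation D Γ → Prop
  | finite _ _ _ _ _ => True
  | infinite _ _ _ _ => False

/-- The result of a derivation. -/
def res : ValidDerivation D Γ → Set (Atom S (GTerm S C V))
  | finite n I _ _ _ => I (Fin.last n)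
  | infinite I _ _ _ => ⋃ i, I i

end ValidDerivation

/-- Every valid chase derivation of `D` w.r.t. `Γ` is finite. -/
def CTForall (D : Set (Atom S C)) (Γ : Set (TGD S V)) : Prop :=
  ∀ δ : ValidDerivation D Γ, δ.IsFinite

/-- Some valid chase derivation of `D` w.r.t. `Γ` is finite. -/
def CTExists (D : Set (Atom S C)) (Γ : Set (TGD S V)) : Prop :=
  ∃ δ : ValidDerivation D Γ, δ.IsFinite

/-- Membership in `chase(D, Γ)`. -/
inductive InChase (D : Set (Atom S C)) (Γ : Set (TGD S V)) : Atom S (GTerm S C V) → Prop where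
  | base (a : Atom S C) (ha : a ∈ D) : InChase D Γ (a.map GTerm.const)
  | step (σ : TGD S V) (hσ : σ ∈ Γ) (h : V → GTerm S C V)
      (hb : ∀ a ∈ σ.body, InChase D Γ (a.map h)) (β : Atom S (GTerm S C V))
      (hβ : β ∈ result σ h) : InChase D Γ β

/-- The instance `chase(D, Γ)`, as the least instance that contains `D` and the results of all its
triggers. By `ValidDerivation.res_eq_chase` below it is the result of every valid chase
derivation of `D` w.r.t. `Γ`. -/
def chase (D : Set (Atom S C)) (Γ : Set (TGD S V)) : Set (Atom S (GTerm S C V)) :=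
  {α | InChase D Γ α}

theorem ValidDerivation.res_eq_chase {D : Set (Atom S C)} {Γ : Set (TGD S V)}
    (δ : ValidDerivation D Γ) : δ.res = chase D Γ := by
  have hstep : ∀ I J : Set (Atom S (GTerm S C V)), Step Γ I J → I ⊆ chase D Γ →
      J ⊆ chase D Γ := by
    rintro I J ⟨σ, h, ⟨⟨hσ, hb⟩, -⟩, rfl⟩ hI
    refine Set.union_subset hI fun β hβ => ?_
    exact InChase.step σ hσ h (fun a ha => hI (hb a ha)) β hβ
  have hinit : toInstance V D ⊆ chase D Γ := by
    rintro _ ⟨a, ha, rfl⟩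
    exact InChase.base a ha
  cases δ with
  | finite n I init step final =>
    have hup : ∀ i : Fin (n + 1), I i ⊆ chase D Γ ∧ I 0 ⊆ I i := by
      intro i
      induction i using Fin.induction with
      | zero => exact ⟨init ▸ hinit, subset_rfl⟩
      | succ i ih =>
        refine ⟨hstep _ _ (step i) ih.1, ih.2.trans ?_⟩
        obtain ⟨σ, h, -, hJ⟩ := step i
        rw [hJ]
        exact Set.subset_union_left
    refine Set.Subset.antisymm (hup _).1 ?_
    intro α hα
    change α ∈ I (Fin.last n)
    induction hα with
    | base a ha => exact (hup _).2 (init ▸ ⟨a, ha, rfl⟩)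
    | step σ hσ h hb β hβ ih =>
      by_contra hn
      exact final σ h ⟨⟨hσ, ih⟩, fun hs => hn (hs hβ)⟩
  | infinite I init step fair =>
    have hmono : Monotone I := by
      refine monotone_nat_of_le_succ fun i => ?_
      obtain ⟨σ, h, -, hJ⟩ := step i
      rw [hJ]
      exact Set.subset_union_left
    have hup : ∀ i, I i ⊆ chase D Γ := by
      intro i
      induction i with
      | zero => exact init ▸ hinit
      | succ i ih => exact hstep _ _ (step i) ih
    refine Set.Subset.antisymm (Set.iUnion_subset hup) ?_
    intro α hα
    change α ∈ ⋃ i, I i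
    induction hα with
    | base a ha => exact Set.mem_iUnion.2 ⟨0, init ▸ ⟨a, ha, rfl⟩⟩
    | step σ hσ h hb β hβ ih =>
      have hfin : ∀ l : List (Atom S V), (∀ a ∈ l, a.map h ∈ ⋃ i, I i) →
          ∃ k, ∀ a ∈ l, a.map h ∈ I k := by
        intro l
        induction l with
        | nil => exact fun _ => ⟨0, by simp⟩
        | cons b l ihl =>
          intro hl
          obtain ⟨k, hk⟩ := ihl fun a ha => hl a (List.mem_cons_of_mem _ ha)
          obtain ⟨j, hj⟩ := Set.mem_iUnion.1 (hl b List.mem_cons_self)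
          refine ⟨max j k, fun a ha => ?_⟩
          rcases List.mem_cons.1 ha with rfl | ha
          · exact hmono (le_max_left _ _) hj
          · exact hmono (le_max_right _ _) (hk a ha)
      obtain ⟨k, hk⟩ := hfin σ.body ih
      by_contra hn
      have hact : ∀ j, k ≤ j → IsActive Γ (I j) σ h := fun j hj =>
        ⟨⟨hσ, fun a ha => hmono hj (hk a ha)⟩, fun hs => hn (Set.mem_iUnion.2 ⟨j, hs hβ⟩)⟩
      obtain ⟨j, hj, hnj⟩ := fair k σ h (hact k le_rfl)
      exact hnj (hact j (le_of_lt hj))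

end TheChase

/-! ## Non-uniform weak acyclicity -/

section WeakAcyclicity

variable {S : Signature} {C V : Type*}

/-- The term `t` occurs at the position `π = (R, i)` in some atom of the list (positions are
numbered from `0`). -/
def OccursAt {T : Type*} (l : List (Atom S T)) (t : T) (π : S.Pred × ℕ) : Prop :=
  ∃ a ∈ l, a.pred = π.1 ∧ a.args[π.2]? = some t

/-- The edges of the dependency graph of `Γ`: the special ones if `special = true`, and the normal
ones if `special = false`. -/
def DepEdge (Γ : Set (TGD S V)) (special : Bool) (π π' : S.Pred × ℕ) : Prop :=
  ∃ σ ∈ Γ, ∃ x ∈ σ.frontier, OccursAt σ.body x π ∧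
    match special with
    | false => OccursAt σ.head x π'
    | true => ∃ z ∈ σ.exVars, OccursAt σ.head z π'

/-- `P` occurs in the head of a TGD of `Γ` whose body mentions `R`. -/
def PredStep (Γ : Set (TGD S V)) (R P : S.Pred) : Prop :=
  ∃ σ ∈ Γ, (∃ a ∈ σ.body, a.pred = R) ∧ ∃ a ∈ σ.head, a.pred = P

/-- `P` is reachable from `R` w.r.t. `Γ`. -/
def Reaches (Γ : Set (TGD S V)) : S.Pred → S.Pred → Prop := Relation.ReflTransGen (PredStep Γ)

/-- `Γ` is `D`-weakly-acyclic: the dependency graph of `Γ` has no `D`-supported cycle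
`v 0, v 1, …, v n = v 0` with a special edge. -/
def IsWeaklyAcyclic (D : Set (Atom S C)) (Γ : Set (TGD S V)) : Prop :=
  ¬ ∃ (n : ℕ) (v : ℕ → S.Pred × ℕ) (s : ℕ → Bool),
    v n = v 0 ∧ (∀ i < n, DepEdge Γ (s i) (v i) (v (i + 1))) ∧ (∃ i < n, s i = true) ∧
    ∃ i ≤ n, ∃ α ∈ D, Reaches Γ α.pred (v i).1

end WeakAcyclicity

/-! ## Tuples -/

section Tuples

variable {T T' : Type*}

open Classical in
/-- Keep only the first occurrence of each term. -/
def unique : List T → List T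
  | [] => []
  | t :: l => t :: (unique l).filter (fun u => decide (u ≠ t))

open Classical in
/-- The identifier of `t` in `l`: the position (from `1`) at which `t` appears in `unique l`. -/
def ident (l : List T) (t : T) : ℕ := (unique l).idxOf t + 1

/-- The tuple of the identifiers of the terms of `l`. -/
def identTuple (l : List T) : List ℕ := l.map (ident l)

/-- `t̄ ≃ ū`: the tuples have the same length and the same equality pattern. -/
def SamePattern (l : List T) (l' : List T') : Prop :=
  l.length = l'.length ∧
    ∀ i j, i < l.length → j < l.length → (l[i]? = l[j]? ↔ l'[i]? = l'[j]?)

theorem mem_unique {l : List T} {t : T} : t ∈ unique l ↔ t ∈ l := by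
  induction l with
  | nil => simp [unique]
  | cons a l ih =>
    by_cases h : t = a
    · simp [unique, h]
    · simp [unique, h, ih]

theorem unique_map {f : T → T'} {l : List T} (hf : Set.InjOn f {t | t ∈ l}) :
    unique (l.map f) = (unique l).map f := by
  induction l with
  | nil => rfl
  | cons a l ih =>
    have hl : Set.InjOn f {t | t ∈ l} := hf.mono fun t ht => List.mem_cons_of_mem _ ht
    rw [List.map_cons, unique, unique, ih hl, List.map_cons, List.filter_map]
    congr 2
    refine List.filter_congr fun u hu => ?_
    have hu' : u ∈ l := mem_unique.1 hu
    have : f u = f a ↔ u = a :=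
      ⟨fun h => hf (List.mem_cons_of_mem _ hu') List.mem_cons_self h, fun h => h ▸ rfl⟩
    simp [this]

open Classical in
theorem ident_injOn (l : List T) : Set.InjOn (ident l) {t | t ∈ l} := by
  intro t ht u _ h
  have h' : (unique l).idxOf t = (unique l).idxOf u := by simpa [ident] using h
  exact (List.idxOf_inj (mem_unique.2 ht)).1 h'

theorem length_unique_identTuple (l : List T) :
    (unique l).length = (unique (identTuple l)).length := by
  rw [identTuple, unique_map (ident_injOn l), List.length_map]

end Tuples

/-! ## Linearization -/

/-- A pair `(α, T)` of an atom and a set of atoms over integers. -/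
structure IntType (S : Signature) where
  guard : Atom S ℕ
  side : Set (Atom S ℕ)

/-- `T ∪ {α}`. -/
def IntType.atoms {S : Signature} (τ : IntType S) : Set (Atom S ℕ) := insert τ.guard τ.side

/-- The signature with a predicate `[τ]`, of the arity of the guard of `τ`, for each `τ`. -/
def linSig (S : Signature) : Signature where
  Pred := IntType S
  arity τ := S.arity τ.guard.pred
  arity_pos τ := S.arity_pos τ.guard.pred

section Linearization

variable {S : Signature} {C V : Type*}

/-- The pair `τ` is a `Γ`-type. The second condition says that the arguments `t₁, …, tₙ` of the
guard satisfy `t₁ = 1` and `1 ≤ tᵢ ≤ max {t₁, …, tᵢ₋₁} + 1` for `i ≥ 2`. -/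
def IsType (Γ : Set (TGD S V)) (τ : IntType S) : Prop :=
  τ.guard.pred ∈ sch Γ ∧
  (∀ i (hi : i < τ.guard.args.length), 1 ≤ τ.guard.args[i] ∧
    τ.guard.args[i] ≤ (τ.guard.args.take i).foldr max 0 + 1) ∧
  ∀ β ∈ τ.side, β.pred ∈ sch Γ ∧ (∀ t ∈ β.args, t ∈ τ.guard.args) ∧ β ≠ τ.guard

/-- The instantiation `τ(ū)`: the arguments of the guard are replaced by `ū`. -/
def IntType.inst {T : Type*} (τ : IntType S) (u : List T) : Set (Atom S T) :=
  {β | ∃ r : ℕ → T, τ.guard.args.map r = u ∧ ∃ γ ∈ τ.atoms, β = γ.map r}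

/-- The type of `α` w.r.t. `D` and `Γ`: the atoms of `chase(D, Γ)` over the schema of `Γ` that
mention only terms of `α`. -/
def typeOf (D : Set (Atom S C)) (Γ : Set (TGD S V)) (α : Atom S (GTerm S C V)) :
    Set (Atom S (GTerm S C V)) :=
  {β ∈ chase D Γ | β.pred ∈ sch Γ ∧ ∀ t ∈ β.args, t ∈ α.args}

/-- The completion of `D` w.r.t. `Γ`: the atoms of `chase(D, Γ)` over the terms of `D`. -/
def completion (D : Set (Atom S C)) (Γ : Set (TGD S V)) : Set (Atom S C) :=
  {β | β.map GTerm.const ∈ chase D Γ ∧ ∀ t ∈ β.args, t ∈ dom D}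

/-- The linearization of a database `D`: the atoms `[τ](t̄)` where `R(t̄) ∈ D` and `τ` is a `Γ`-type
with guard `R(ū)`, `ū ≃ t̄`, such that `τ(t̄)` is the type of `R(t̄)`. -/
def linDB (D : Set (Atom S C)) (Γ : Set (TGD S V)) : Set (Atom (linSig S) C) :=
  {b | ∃ α ∈ D, ∃ τ : IntType S, IsType Γ τ ∧ τ.guard.pred = α.pred ∧
    SamePattern τ.guard.args α.args ∧
    τ.inst (α.map GTerm.const).args = typeOf D Γ (α.map (GTerm.const (S := S) (V := V))) ∧
    b.pred = τ ∧ b.args = α.args}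

open Classical in
/-- `h` on the frontier, and pairwise distinct fresh constants for the existentially quantified
variables. -/
def linSubst (σ : TGD S V) (h : V → ℕ) (x : V) : ℕ ⊕ V :=
  if x ∈ σ.frontier then Sum.inl (h x) else Sum.inr x

/-- The atoms `α₁, …, αₘ` obtained from the head, together with the atoms of `τ`. -/
def linInst (σ : TGD S V) (τ : IntType S) (h : V → ℕ) : Set (Atom S (ℕ ⊕ V)) :=
  {α | ∃ a ∈ σ.head, α = a.map (linSubst σ h)} ∪ Atom.map Sum.inl '' τ.atoms

/-- The type that replaces the predicate of the head atom `a`: the atom `α = f(a)` and the other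
atoms over its terms in the completion, the terms of `α` being renamed to `1, 2, …` in the order
of their first occurrence in `α`. -/
def linHeadType (Γ : Set (TGD S V)) (σ : TGD S V) (τ : IntType S) (h : V → ℕ) (a : Atom S V) :
    IntType S where
  guard := (a.map (linSubst σ h)).map (ident (a.map (linSubst σ h)).args)
  side := Atom.map (ident (a.map (linSubst σ h)).args) ''
    ({β ∈ completion (linInst σ τ h) Γ | ∀ t ∈ β.args, t ∈ (a.map (linSubst σ h)).args} \
      {a.map (linSubst σ h)})

/-- The linearization of `σ`, with guard `g`, induced by `τ` and `h`. -/
def linTGD (Γ : Set (TGD S V)) (σ : TGD S V) (g : Atom S V) (τ : IntType S) (h : V → ℕ)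
    (hg : g.map h = τ.guard) : TGD (linSig S) V where
  body := [{ pred := τ
             args := g.args
             length_args := g.length_args.trans
               (congrArg S.arity (congrArg Atom.pred hg)) }]
  head := σ.head.map fun a =>
    { pred := linHeadType Γ σ τ h a
      args := a.args
      length_args := a.length_args }
  body_ne := List.cons_ne_nil _ _
  head_ne := fun e => σ.head_ne (List.map_eq_nil_iff.1 e)

/-- The linearization of `Γ`: all linearizations of its TGDs induced by a `Γ`-type `τ` and a
homomorphism `h` from the body to the atoms of `τ` that maps the guard to the guard of `τ`. -/
def linTGDs (Γ : Set (TGD S V)) : Set (TGD (linSig S) V) :=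
  {σ' | ∃ σ ∈ Γ, ∃ g, σ.guard? = some g ∧ ∃ τ, IsType Γ τ ∧ ∃ h : V → ℕ,
    (∀ a ∈ σ.body, a.map h ∈ τ.atoms) ∧ ∃ hg : g.map h = τ.guard, σ' = linTGD Γ σ g τ h hg}

end Linearization

/-! ## Simplification -/

/-- A predicate `R_ℓ`, where `ℓ` is a tuple of integers whose length is the arity of `R`. -/
structure SimplePred (S : Signature) where
  base : S.Pred
  ids : List ℕ
  length_ids : ids.length = S.arity base

/-- The signature of the predicates `R_ℓ`; the arity of `R_ℓ` is the number of distinct integers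
in `ℓ`. -/
def simpleSig (S : Signature) : Signature where
  Pred := SimplePred S
  arity p := (unique p.ids).length
  arity_pos p := by
    have h : 0 < p.ids.length := p.length_ids ▸ S.arity_pos p.base
    exact List.length_pos_of_mem (mem_unique.2 (List.getElem_mem h))

section Simplification

variable {S : Signature} {C V : Type*}

/-- The simplification of `R(t̄)`: the atom `R_{id(t̄)}(unique(t̄))`. -/
def simpleAtom {T : Type*} (a : Atom S T) : Atom (simpleSig S) T where
  pred := { base := a.pred
            ids := identTuple a.args
            length_ids := by rw [identTuple, List.length_map]; exact a.length_args }
  args := unique a.args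
  length_args := length_unique_identTuple a.args

/-- The simplification of a set of atoms. -/
def simpleDB (D : Set (Atom S C)) : Set (Atom (simpleSig S) C) := simpleAtom '' D

/-- `f` is a specialization of the tuple `x₁, …, xₙ`: `f(xᵢ) ∈ {f(x₁), …, f(xᵢ₋₁), xᵢ}` for each
`i`; `f` is extended by the identity to the other variables. -/
def IsSpecialization (l : List V) (f : V → V) : Prop :=
  (∀ i (hi : i < l.length), f l[i] = l[i] ∨ f l[i] ∈ (l.take i).map f) ∧ ∀ v, v ∉ l → f v = v

/-- The simplification of a TGD induced by `f`. -/
def simpleTGD (σ : TGD S V) (f : V → V) : TGD (simpleSig S) V where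
  body := σ.body.map fun a => simpleAtom (a.map f)
  head := σ.head.map fun a => simpleAtom (a.map f)
  body_ne := fun e => σ.body_ne (List.map_eq_nil_iff.1 e)
  head_ne := fun e => σ.head_ne (List.map_eq_nil_iff.1 e)

/-- The simplification of a set of linear TGDs: all simplifications of its TGDs `R(x̄) → ∃ z̄ ψ`
induced by a specialization of `x̄`. -/
def simpleTGDs (Γ : Set (TGD S V)) : Set (TGD (simpleSig S) V) :=
  {σ' | ∃ σ ∈ Γ, ∃ a, σ.body = [a] ∧ ∃ f, IsSpecialization a.args f ∧ σ' = simpleTGD σ f}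

end Simplification

end

end SOChase

open SOChase

/-!
The three finiteness conditions on derivations and on the chase are equivalent because a chase step
adds finitely many new atoms and because a fair derivation always exists
(`nonempty_validDerivation`): the results of all triggers form a countable set, and one applies at
each stage an active trigger whose result has the least code.

The link with weak acyclicity rests on the locality of the guarded chase (`rename_mem_chase`): an
atom that contains a null of a trigger `(σ, h)`, or a term built from such a null, mentions besides
terms of this kind only frontier values of the trigger. Therefore the type of an atom of
`result(σ, h)` depends only on `σ` and on the type of the image of the guard, and it is the type
which the linearization attaches to the head atom (`linHeadType_eq`). So the pairs of a type and a
position of the simplified linearization that are reachable from the database are exactly the places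
at which a term can occur in an atom of the chase. A normal edge of the dependency graph keeps the term, and a special edge
leads from a term to a null whose name contains it.

If there is a supported cycle with a special edge, it can be followed in the chase, and each round
produces deeper terms (`isWeaklyAcyclic_of_finite_chase`). If there is none, a term of depth `k`
yields a chain of at least `k` distinct nodes, so that the depth is at most the number
of nodes, which `depthBound` dominates (`depthLe_of_isWeaklyAcyclic`, `ncard_realizedNodes_le`).

A bound on the depth bounds the size as follows. The terms of an atom of depth at most `d` lie in
one bag of level at most `d` (`exists_isBag`), where a bag consists of the terms of a database atom,
or of the terms of the result of a trigger whose frontier values lie in a bag of the previous level.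
With `a` atoms and maximal arity `m` in the TGDs, bags have at most `a m` elements and each bag has
at most `a (a m) ^ m` successors, which gives the bound on the number of atoms
(`encard_chase_le_of_depthLe`).
-/

namespace SOChase

/-! ### Tuples and their identifiers -/

section Tuples

variable {T T' : Type*}

theorem idxOf_map_of_injOn [DecidableEq T] [DecidableEq T'] {f : T → T'} {l : List T} {t : T}
    (hf : ∀ u ∈ l, f u = f t → u = t) : (l.map f).idxOf (f t) = l.idxOf t := by
  induction l with
  | nil => rfl
  | cons a l ih =>
    have ih' := ih fun u hu => hf u (List.mem_cons_of_mem _ hu)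
    by_cases h : a = t
    · subst h; simp
    · have h' : f a ≠ f t := fun e => h (hf a List.mem_cons_self e)
      rw [List.map_cons, List.idxOf_cons_ne _ h', List.idxOf_cons_ne _ h, ih']

theorem ident_map {f : T → T'} {l : List T} (hf : Set.InjOn f {t | t ∈ l}) {t : T} (ht : t ∈ l) :
    ident (l.map f) (f t) = ident l t := by
  classical
  unfold ident
  rw [unique_map hf, idxOf_map_of_injOn]
  intro u hu e
  exact hf (mem_unique.1 hu) ht e

theorem identTuple_map {f : T → T'} {l : List T} (hf : Set.InjOn f {t | t ∈ l}) :
    identTuple (l.map f) = identTuple l := by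
  unfold identTuple
  rw [List.map_map]
  exact List.map_congr_left fun t ht => ident_map hf ht

theorem length_unique_le (l : List T) : (unique l).length ≤ l.length := by
  induction l with
  | nil => exact le_rfl
  | cons a l ih =>
    rw [unique, List.length_cons, List.length_cons]
    exact Nat.succ_le_succ ((List.length_filter_le _ _).trans ih)

theorem one_le_ident (l : List T) (t : T) : 1 ≤ ident l t := Nat.le_add_left _ _

theorem ident_le_length {l : List T} {t : T} (ht : t ∈ l) : ident l t ≤ l.length := by
  classical
  refine le_trans ?_ (length_unique_le l)
  have := List.idxOf_lt_length_iff.2 (mem_unique.2 ht)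
  exact this

theorem unique_getElem?_ident {l : List T} {t : T} (ht : t ∈ l) :
    (unique l)[ident l t - 1]? = some t := by
  classical
  have h := List.getElem?_idxOf (mem_unique.2 ht)
  exact h

theorem unique_append_of_mem {l : List T} {t : T} (ht : t ∈ l) :
    unique (l ++ [t]) = unique l := by
  classical
  induction l with
  | nil => simp at ht
  | cons a l ih =>
    rw [List.cons_append, unique, unique]
    by_cases h : t ∈ l
    · rw [ih h]
    · obtain rfl : t = a := (List.mem_cons.1 ht).resolve_right h
      congr 1
      clear ih ht
      induction l with
      | nil => simp [unique]
      | cons b l ih =>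
        rw [List.mem_cons, not_or] at h
        rw [List.cons_append, unique, unique, List.filter_cons, List.filter_cons,
          List.filter_filter, List.filter_filter]
        simp only [Bool.and_comm (decide (_ ≠ t)), ← List.filter_filter]
        rw [ih h.2]

theorem unique_append_of_not_mem {l : List T} {t : T} (ht : t ∉ l) :
    unique (l ++ [t]) = unique l ++ [t] := by
  classical
  induction l with
  | nil => simp [unique]
  | cons a l ih =>
    rw [List.mem_cons, not_or] at ht
    rw [List.cons_append, unique, unique, ih ht.2, List.filter_append]
    simp [ht.1]

theorem ident_append_of_mem {l : List T} {s t : T} (ht : t ∈ l) :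
    ident (l ++ [s]) t = ident l t := by
  classical
  unfold ident
  by_cases hs : s ∈ l
  · rw [unique_append_of_mem hs]
  · rw [unique_append_of_not_mem hs, List.idxOf_append_of_mem (mem_unique.2 ht)]

theorem ident_append_self {l : List T} {t : T} (ht : t ∉ l) :
    ident (l ++ [t]) t = (unique l).length + 1 := by
  classical
  unfold ident
  rw [unique_append_of_not_mem ht, List.idxOf_append_of_notMem (fun h => ht (mem_unique.1 h))]
  simp

theorem identTuple_append_singleton (l : List T) (t : T) :
    identTuple (l ++ [t]) = identTuple l ++ [ident (l ++ [t]) t] := by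
  unfold identTuple
  rw [List.map_append]
  congr 1
  exact List.map_congr_left fun s hs => ident_append_of_mem hs

/-- The condition `1 ≤ tᵢ ≤ max {t₁, …, tᵢ₋₁} + 1` on a tuple of integers. -/
def IsCanonical (l : List ℕ) : Prop :=
  ∀ i (hi : i < l.length), 1 ≤ l[i] ∧ l[i] ≤ (l.take i).foldr max 0 + 1

theorem foldr_max_append_singleton (l : List ℕ) (x : ℕ) :
    (l ++ [x]).foldr max 0 = max (l.foldr max 0) x := by
  induction l with
  | nil => simp
  | cons a l ih => simp only [List.cons_append, List.foldr_cons, ih, max_assoc]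

theorem isCanonical_append_singleton {l : List ℕ} {x : ℕ} :
    IsCanonical (l ++ [x]) ↔ IsCanonical l ∧ 1 ≤ x ∧ x ≤ l.foldr max 0 + 1 := by
  constructor
  · intro h
    refine ⟨fun i hi => ?_, ?_⟩
    · have := h i (by simp; omega)
      rwa [List.getElem_append_left hi, List.take_append_of_le_length hi.le] at this
    · have := h l.length (by simp)
      simpa using this
  · rintro ⟨h, hx⟩ i hi
    by_cases hi' : i < l.length
    · rw [List.getElem_append_left hi', List.take_append_of_le_length hi'.le]
      exact h i hi'
    · obtain rfl : i = l.length := by simp at hi; omega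
      simpa using hx

theorem isCanonical_identTuple_aux (l : List T) :
    IsCanonical (identTuple l) ∧ (identTuple l).foldr max 0 = (unique l).length := by
  induction l using List.reverseRecOn with
  | nil => exact ⟨fun i hi => absurd hi (by simp [identTuple]), rfl⟩
  | append_singleton l t ih =>
    rw [identTuple_append_singleton, isCanonical_append_singleton, foldr_max_append_singleton, ih.2]
    by_cases ht : t ∈ l
    · have hle : ident l t ≤ (unique l).length := by
        classical
        exact List.idxOf_lt_length_iff.2 (mem_unique.2 ht)
      rw [unique_append_of_mem ht, ident_append_of_mem ht]
      exact ⟨⟨ih.1, one_le_ident _ _, by omega⟩, max_eq_left hle⟩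
    · rw [unique_append_of_not_mem ht, ident_append_self ht]
      exact ⟨⟨ih.1, by omega, by omega⟩, by simp⟩

theorem isCanonical_identTuple (l : List T) : IsCanonical (identTuple l) :=
  (isCanonical_identTuple_aux l).1

theorem IsCanonical.unique_eq {l : List ℕ} (h : IsCanonical l) :
    unique l = List.range' 1 (l.foldr max 0) := by
  induction l using List.reverseRecOn with
  | nil => simp [unique]
  | append_singleton l x ih =>
    obtain ⟨hl, h1, hx⟩ := isCanonical_append_singleton.1 h
    have ih := ih hl
    rw [foldr_max_append_singleton]
    by_cases hm : x ∈ l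
    · have : x ∈ unique l := mem_unique.2 hm
      rw [ih, List.mem_range'_1] at this
      rw [unique_append_of_mem hm, ih, max_eq_left (by omega)]
    · have : x ∉ unique l := fun hx => hm (mem_unique.1 hx)
      rw [ih, List.mem_range'_1] at this
      obtain rfl : x = l.foldr max 0 + 1 := by omega
      rw [unique_append_of_not_mem hm, ih, max_eq_right (by omega), List.range'_concat]
      simp [add_comm]

theorem IsCanonical.ident_eq {l : List ℕ} (h : IsCanonical l) {t : ℕ} (ht : t ∈ l) :
    ident l t = t := by
  have h1 := unique_getElem?_ident ht
  rw [h.unique_eq] at h1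
  have h2 := one_le_ident l t
  rw [List.getElem?_eq_some_iff] at h1
  obtain ⟨_, h1⟩ := h1
  rw [List.getElem_range'] at h1
  omega

theorem IsCanonical.identTuple_eq {l : List ℕ} (h : IsCanonical l) : identTuple l = l :=
  (List.map_congr_left fun _ ht => h.ident_eq ht).trans (List.map_id _)

/-- Tuples with the same equality pattern have the same tuple of identifiers. -/
theorem SamePattern.identTuple_eq {l : List T} {l' : List T'} (h : SamePattern l l') :
    identTuple l = identTuple l' := by
  classical
  rcases l with - | ⟨a, l0⟩
  · obtain rfl : l' = [] := List.length_eq_zero_iff.1 h.1.symm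
    rfl
  rcases l' with - | ⟨a', l0'⟩
  · exact absurd h.1 (by simp)
  generalize hl : a :: l0 = l at h
  generalize hl' : a' :: l0' = l' at h
  -- the map that sends each entry of `l` to the corresponding entry of `l'`
  let f : T → T' := fun t => (l'[l.idxOf t]?).getD a'
  have hf : ∀ i (hi : i < l.length), f l[i] = l'[i]'(h.1 ▸ hi) := by
    intro i hi
    have hj : l.idxOf l[i] < l.length := List.idxOf_lt_length_iff.2 (List.getElem_mem hi)
    have := (h.2 _ _ hj hi).1 (by rw [List.getElem?_idxOf (List.getElem_mem hi)]; simp)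
    simp only [f]
    rw [this, List.getElem?_eq_getElem (h.1 ▸ hi)]
    rfl
  have hmap : l.map f = l' := by
    refine List.ext_getElem (by simpa using h.1) fun i hi hi' => ?_
    rw [List.getElem_map]
    exact hf i (by simpa using hi)
  rw [← hmap, identTuple_map]
  intro t ht u hu e
  obtain ⟨i, hi, rfl⟩ := List.getElem_of_mem ht
  obtain ⟨j, hj, rfl⟩ := List.getElem_of_mem hu
  rw [hf i hi, hf j hj] at e
  have := (h.2 i j hi hj).2 (by
    rw [List.getElem?_eq_getElem (h.1 ▸ hi), List.getElem?_eq_getElem (h.1 ▸ hj), e])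
  simpa [List.getElem?_eq_getElem hi, List.getElem?_eq_getElem hj] using this

theorem samePattern_map {f : T → T'} {l : List T} (hf : Set.InjOn f {t | t ∈ l}) :
    SamePattern (l.map f) l := by
  refine ⟨List.length_map _, fun i j hi hj => ?_⟩
  rw [List.length_map] at hi hj
  rw [List.getElem?_map, List.getElem?_map, List.getElem?_eq_getElem hi,
    List.getElem?_eq_getElem hj]
  simp only [Option.map_some, Option.some.injEq]
  exact ⟨fun e => hf (List.getElem_mem hi) (List.getElem_mem hj) e, fun e => congrArg f e⟩

/-- Two maps that produce tuples with the same identifiers identify the same entries. -/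
theorem map_eq_map_iff_of_identTuple_eq {U : Type*} {f : U → T} {g : U → T'} {l : List U}
    (h : identTuple (l.map f) = identTuple (l.map g)) {u v : U} (hu : u ∈ l) (hv : v ∈ l) :
    f u = f v ↔ g u = g v := by
  have key : ∀ w ∈ l, ident (l.map f) (f w) = ident (l.map g) (g w) := by
    unfold identTuple at h
    rw [List.map_map, List.map_map] at h
    exact List.map_inj_left.1 h
  constructor
  · intro e
    refine ident_injOn (l.map g) (List.mem_map_of_mem hu) (List.mem_map_of_mem hv) ?_
    rw [← key u hu, ← key v hv, e]
  · intro e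
    refine ident_injOn (l.map f) (List.mem_map_of_mem hu) (List.mem_map_of_mem hv) ?_
    rw [key u hu, key v hv, e]

/-- The inverse of `ident l` on the entries of `l`, with default value `d`. -/
noncomputable def entry (l : List T) (d : T) (k : ℕ) : T := ((unique l)[k - 1]?).getD d

theorem entry_ident {l : List T} (d : T) {t : T} (ht : t ∈ l) : entry l d (ident l t) = t := by
  rw [entry, unique_getElem?_ident ht]
  rfl

theorem map_entry_identTuple (l : List T) (d : T) : (identTuple l).map (entry l d) = l := by
  unfold identTuple
  rw [List.map_map]
  exact (List.map_congr_left fun t ht => entry_ident d ht).trans (List.map_id _)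

end Tuples

/-! ### Finiteness of derivations and of the chase -/

section Derivations

variable {S : Signature} {C V : Type*}

open Classical in
/-- The substitution applied to the head of `σ`, as a function of the frontier values alone. -/
noncomputable def frontierSubst (σ : TGD S V) (φ : {x // x ∈ σ.frontier} → GTerm S C V) (x : V) :
    GTerm S C V :=
  if hx : x ∈ σ.frontier then φ ⟨x, hx⟩ else GTerm.null σ φ x

theorem headSubst_eq_frontierSubst (σ : TGD S V) (h : V → GTerm S C V) :
    headSubst σ h = frontierSubst σ (fun y => h y.1) := by
  funext x
  unfold headSubst frontierSubst
  split_ifs <;> rfl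

theorem headSubst_of_mem {σ : TGD S V} {h : V → GTerm S C V} {x : V} (hx : x ∈ σ.frontier) :
    headSubst σ h x = h x := if_pos hx

theorem headSubst_of_not_mem {σ : TGD S V} {h : V → GTerm S C V} {x : V} (hx : x ∉ σ.frontier) :
    headSubst σ h x = GTerm.null σ (fun y => h y.1) x := if_neg hx

theorem finite_dom_list (l : List (Atom S V)) : (dom {a | a ∈ l}).Finite := by
  have : dom {a | a ∈ l} = ⋃ a ∈ {a | a ∈ l}, {t | t ∈ a.args} := by
    ext t; simp [dom]
  rw [this]
  exact (List.finite_toSet l).biUnion fun a _ => List.finite_toSet _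

theorem finite_dom {T : Type*} {I : Set (Atom S T)} (hI : I.Finite) : (dom I).Finite := by
  have : dom I = ⋃ a ∈ I, {t | t ∈ a.args} := by
    ext t; simp [dom]
  rw [this]
  exact hI.biUnion fun a _ => List.finite_toSet _

theorem TGD.finite_frontier (σ : TGD S V) : σ.frontier.Finite :=
  (finite_dom_list σ.body).subset Set.inter_subset_left

instance (σ : TGD S V) : Finite {x // x ∈ σ.frontier} := σ.finite_frontier

theorem finite_result (σ : TGD S V) (h : V → GTerm S C V) : (result σ h).Finite := by
  have : result σ h = (fun a => a.map (headSubst σ h)) '' {a | a ∈ σ.head} := by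
    ext β
    simp only [result, Set.mem_ofPred_eq, Set.mem_image]
    exact exists_congr fun a => and_congr_right fun _ => eq_comm
  rw [this]
  exact (List.finite_toSet _).image _

/-- The results of all triggers for `Γ` on `I`. -/
def triggerResults (Γ : Set (TGD S V)) (I : Set (Atom S (GTerm S C V))) :
    Set (Set (Atom S (GTerm S C V))) :=
  {R | ∃ σ h, IsTrigger Γ I σ h ∧ R = result σ h}

theorem finite_triggerResults {Γ : Set (TGD S V)} (hΓ : Γ.Finite)
    {I : Set (Atom S (GTerm S C V))} (hI : I.Finite) : (triggerResults Γ I).Finite := by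
  have key : ∀ σ ∈ Γ, ((fun φ : {x // x ∈ σ.frontier} → GTerm S C V =>
      {β | ∃ a ∈ σ.head, β = a.map (frontierSubst σ φ)}) ''
        (Set.univ.pi fun _ => dom I)).Finite := fun σ _ =>
    (Set.Finite.pi fun _ => finite_dom hI).image _
  refine (hΓ.biUnion key).subset ?_
  rintro _ ⟨σ, h, ⟨hσ, hb⟩, rfl⟩
  refine Set.mem_biUnion hσ ⟨fun y => h y.1, ?_, ?_⟩
  · rintro ⟨y, hy⟩ -
    obtain ⟨a, ha, hya⟩ := hy.1
    exact ⟨a.map h, hb a ha, List.mem_map_of_mem hya⟩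
  · simp only [result, headSubst_eq_frontierSubst]

/-- The atoms of the chase that are obtained after `n` rounds. -/
def chaseLevel (D : Set (Atom S C)) (Γ : Set (TGD S V)) : ℕ → Set (Atom S (GTerm S C V))
  | 0 => toInstance V D
  | n + 1 => chaseLevel D Γ n ∪ ⋃₀ triggerResults Γ (chaseLevel D Γ n)

theorem finite_chaseLevel {D : Set (Atom S C)} {Γ : Set (TGD S V)} (hD : D.Finite)
    (hΓ : Γ.Finite) (n : ℕ) : (chaseLevel D Γ n).Finite := by
  induction n with
  | zero => exact hD.image _
  | succ n ih =>
    refine ih.union ((finite_triggerResults hΓ ih).sUnion ?_)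
    rintro _ ⟨σ, h, -, rfl⟩
    exact finite_result σ h

theorem chaseLevel_mono (D : Set (Atom S C)) (Γ : Set (TGD S V)) : Monotone (chaseLevel D Γ) :=
  monotone_nat_of_le_succ fun _ => Set.subset_union_left

theorem exists_forall_mem_of_monotone {T : Type*} {I : ℕ → Set (Atom S T)} (hI : Monotone I)
    (h : V → T) (l : List (Atom S V)) (hl : ∀ a ∈ l, ∃ n, a.map h ∈ I n) :
    ∃ n, ∀ a ∈ l, a.map h ∈ I n := by
  induction l with
  | nil => exact ⟨0, by simp⟩
  | cons b l ih =>
    obtain ⟨k, hk⟩ := ih fun a ha => hl a (List.mem_cons_of_mem _ ha)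
    obtain ⟨j, hj⟩ := hl b List.mem_cons_self
    refine ⟨max j k, fun a ha => ?_⟩
    rcases List.mem_cons.1 ha with rfl | ha
    · exact hI (le_max_left _ _) hj
    · exact hI (le_max_right _ _) (hk a ha)

theorem chase_subset_iUnion_chaseLevel (D : Set (Atom S C)) (Γ : Set (TGD S V)) :
    chase D Γ ⊆ ⋃ n, chaseLevel D Γ n := by
  intro α hα
  induction hα with
  | base a ha => exact Set.mem_iUnion.2 ⟨0, ⟨a, ha, rfl⟩⟩
  | step σ hσ h hb β hβ ih =>
    obtain ⟨n, hn⟩ := exists_forall_mem_of_monotone (chaseLevel_mono D Γ) h σ.body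
      fun a ha => Set.mem_iUnion.1 (ih a ha)
    exact Set.mem_iUnion.2 ⟨n + 1, Or.inr ⟨_, ⟨σ, h, ⟨hσ, hn⟩, rfl⟩, hβ⟩⟩

theorem countable_chase {D : Set (Atom S C)} {Γ : Set (TGD S V)} (hD : D.Finite)
    (hΓ : Γ.Finite) : (chase D Γ).Countable :=
  (Set.countable_iUnion fun n => (finite_chaseLevel hD hΓ n).countable).mono
    (chase_subset_iUnion_chaseLevel D Γ)

theorem countable_triggerResults_chase {D : Set (Atom S C)} {Γ : Set (TGD S V)} (hD : D.Finite)
    (hΓ : Γ.Finite) : (triggerResults Γ (chase D Γ)).Countable := by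
  refine (Set.countable_ofPred_finite_subset (countable_chase hD hΓ)).mono ?_
  rintro _ ⟨σ, h, ⟨hσ, hb⟩, rfl⟩
  exact ⟨finite_result σ h, fun β hβ => InChase.step σ hσ h hb β hβ⟩

theorem Step.subset {Γ : Set (TGD S V)} {I J : Set (Atom S (GTerm S C V))} (h : Step Γ I J) :
    I ⊆ J := by
  obtain ⟨σ, h, -, rfl⟩ := h
  exact Set.subset_union_left

theorem Step.subset_chase {D : Set (Atom S C)} {Γ : Set (TGD S V)}
    {I J : Set (Atom S (GTerm S C V))} (h : Step Γ I J) (hI : I ⊆ chase D Γ) :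
    J ⊆ chase D Γ := by
  obtain ⟨σ, h, ⟨⟨hσ, hb⟩, -⟩, rfl⟩ := h
  exact Set.union_subset hI fun β hβ => InChase.step σ hσ h (fun a ha => hI (hb a ha)) β hβ

/-- Fairness is ensured by applying, at each stage, an active trigger whose result has the least
code in a fixed enumeration of the results of all triggers. -/
theorem nonempty_validDerivation {D : Set (Atom S C)} {Γ : Set (TGD S V)} (hD : D.Finite)
    (hΓ : Γ.Finite) : Nonempty (ValidDerivation D Γ) := by
  classical
  obtain ⟨e, he⟩ := Set.countable_iff_exists_injOn.1 (countable_triggerResults_chase (Γ := Γ) hD hΓ)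
  have hnext : ∀ I : Set (Atom S (GTerm S C V)), ∃ J, (∃ σ h, IsActive Γ I σ h) →
      ∃ σ h, IsActive Γ I σ h ∧ J = I ∪ result σ h ∧
        ∀ σ' h', IsActive Γ I σ' h' → e (result σ h) ≤ e (result σ' h') := by
    intro I
    by_cases hI : ∃ σ h, IsActive Γ I σ h
    · have hne : {k | ∃ σ h, IsActive Γ I σ h ∧ k = e (result σ h)}.Nonempty := by
        obtain ⟨σ, h, hact⟩ := hI
        exact ⟨_, σ, h, hact, rfl⟩
      obtain ⟨σ, h, hact, hk⟩ := Nat.sInf_mem hne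
      refine ⟨I ∪ result σ h, fun _ => ⟨σ, h, hact, rfl, fun σ' h' hact' => ?_⟩⟩
      rw [← hk]
      exact Nat.sInf_le ⟨σ', h', hact', rfl⟩
    · exact ⟨I, fun h => absurd h hI⟩
  choose next hnext using hnext
  let I : ℕ → Set (Atom S (GTerm S C V)) := fun n => next^[n] (toInstance V D)
  have hsucc : ∀ n, I (n + 1) = next (I n) := fun n => Function.iterate_succ_apply' _ _ _
  have hstep : ∀ n, (∃ σ h, IsActive Γ (I n) σ h) → Step Γ (I n) (I (n + 1)) := by
    intro n hn
    obtain ⟨σ, h, hact, hJ, -⟩ := hnext (I n) hn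
    exact ⟨σ, h, hact, (hsucc n).trans hJ⟩
  by_cases hend : ∃ n, ¬ ∃ σ h, IsActive Γ (I n) σ h
  · refine ⟨.finite (Nat.find hend) (fun i => I i) rfl (fun i => ?_) ?_⟩
    · exact hstep i (not_not.1 (Nat.find_min hend i.2))
    · intro σ h hact
      exact Nat.find_spec hend ⟨σ, h, hact⟩
  · rw [not_exists] at hend
    have hact := fun n => not_not.1 (hend n)
    have hmono : Monotone I := monotone_nat_of_le_succ fun n => (hstep n (hact n)).subset
    have hsub : ∀ n, I n ⊆ chase D Γ := by
      intro n
      induction n with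
      | zero => rintro _ ⟨a, ha, rfl⟩; exact InChase.base a ha
      | succ n ih => exact (hstep n (hact n)).subset_chase ih
    refine ⟨.infinite I rfl (fun n => hstep n (hact n)) fun i σ h hi => ?_⟩
    by_contra hcon
    simp only [not_exists, not_and, not_not] at hcon
    choose s k hsk hnxt hmin using fun n => hnext (I n) (hact n)
    -- the codes of the results applied after stage `i` are distinct and bounded
    have hbdd : ∀ n, e (result (s (i + n)) (k (i + n))) ≤ e (result σ h) := by
      intro n
      refine hmin (i + n) σ h ?_
      rcases Nat.eq_zero_or_pos n with rfl | hn
      · exact hi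
      · exact hcon (i + n) (by omega)
    have hmem : ∀ n, result (s n) (k n) ∈ triggerResults Γ (chase D Γ) := fun n =>
      ⟨_, _, ⟨(hsk n).1.1, fun a ha => hsub n ((hsk n).1.2 a ha)⟩, rfl⟩
    have hinj : Function.Injective fun n => e (result (s (i + n)) (k (i + n))) := by
      have hlt : ∀ m n, m < n → e (result (s (i + m)) (k (i + m))) ≠
          e (result (s (i + n)) (k (i + n))) := by
        intro m n hmn heq
        have heq := he (hmem _) (hmem _) heq
        refine (hsk (i + n)).2 ?_
        rw [← heq]
        refine Set.Subset.trans ?_ (hmono (show i + m + 1 ≤ i + n by omega))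
        rw [hsucc, hnxt]
        exact Set.subset_union_right
      intro m n hmn
      rcases lt_trichotomy m n with hlt' | rfl | hlt'
      · exact absurd hmn (hlt m n hlt')
      · rfl
      · exact absurd hmn.symm (hlt n m hlt')
    exact Set.infinite_range_of_injective hinj
      ((Set.finite_Iic (e (result σ h))).subset (Set.range_subset_iff.2 hbdd))

theorem ctExists_of_ctForall {D : Set (Atom S C)} {Γ : Set (TGD S V)} (hD : D.Finite)
    (hΓ : Γ.Finite) (h : CTForall D Γ) : CTExists D Γ := by
  obtain ⟨δ⟩ := nonempty_validDerivation hD hΓ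
  exact ⟨δ, h δ⟩

theorem finite_chase_of_ctExists {D : Set (Atom S C)} {Γ : Set (TGD S V)} (hD : D.Finite)
    (h : CTExists D Γ) : (chase D Γ).Finite := by
  obtain ⟨δ, hδ⟩ := h
  rw [← δ.res_eq_chase]
  cases δ with
  | infinite => exact hδ.elim
  | finite n I init step final =>
    have : ∀ i, (I i).Finite := by
      intro i
      induction i using Fin.induction with
      | zero => rw [init]; exact hD.image _
      | succ i ih =>
        obtain ⟨σ, h, -, hJ⟩ := step i
        rw [hJ]
        exact ih.union (finite_result σ h)
    exact this _

theorem ctForall_of_finite_chase {D : Set (Atom S C)} {Γ : Set (TGD S V)}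
    (h : (chase D Γ).Finite) : CTForall D Γ := by
  intro δ
  rw [← δ.res_eq_chase] at h
  cases δ with
  | finite => exact trivial
  | infinite I init step fair =>
    have hmono : StrictMono I := by
      refine strictMono_nat_of_lt_succ fun n => ⟨(step n).subset, fun hle => ?_⟩
      obtain ⟨σ, k, hact, hJ⟩ := step n
      refine hact.2 (Set.Subset.trans ?_ hle)
      rw [hJ]
      exact Set.subset_union_right
    exact (Set.infinite_range_of_injective hmono.injective
      (h.finite_subsets.subset (Set.range_subset_iff.2 fun n => Set.subset_iUnion I n))).elim

end Derivations

/-! ### Types of atoms -/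

section Types

variable {S : Signature} {C V T T' : Type*}

theorem Atom.map_map {T'' : Type*} (a : Atom S T) (f : T → T') (g : T' → T'') :
    (a.map f).map g = a.map (g ∘ f) := by
  ext1
  · rfl
  · exact List.map_map

theorem Atom.map_congr {a : Atom S T} {f g : T → T'} (h : ∀ t ∈ a.args, f t = g t) :
    a.map f = a.map g := by
  ext1
  · rfl
  · exact List.map_congr_left h

theorem Atom.map_eq_self {a : Atom S T} {f : T → T} (h : ∀ t ∈ a.args, f t = t) :
    a.map f = a := by
  ext1
  · rfl
  · exact (List.map_congr_left h).trans (List.map_id _)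

theorem Atom.args_ne_nil (a : Atom S T) : a.args ≠ [] := by
  intro h
  have h1 := a.length_args
  rw [h] at h1
  exact (S.arity_pos a.pred).ne h1

theorem Atom.exists_mem_args (a : Atom S T) : ∃ t, t ∈ a.args :=
  List.exists_mem_of_ne_nil _ a.args_ne_nil

theorem Atom.mem_args_map {a : Atom S T} {f : T → T'} {t : T'} :
    t ∈ (a.map f).args ↔ ∃ s ∈ a.args, f s = t := List.mem_map

/-- An atom over the image of `f` is the image of an atom. -/
theorem Atom.exists_map_eq {f : T → T'} {P : T → Prop} (b : Atom S T')
    (h : ∀ t ∈ b.args, ∃ s, P s ∧ f s = t) : ∃ a : Atom S T, (∀ t ∈ a.args, P t) ∧ a.map f = b := by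
  obtain ⟨t, ht⟩ := b.exists_mem_args
  have : Nonempty T := ⟨(h t ht).choose⟩
  choose! r hr using h
  refine ⟨b.map r, ?_, ?_⟩
  · intro t ht
    obtain ⟨s, hs, rfl⟩ := Atom.mem_args_map.1 ht
    exact (hr s hs).1
  · rw [Atom.map_map]
    exact Atom.map_eq_self fun t ht => (hr t ht).2

/-- The canonical type of `α` in the set of atoms `X`: the atoms of `X` over the terms of `α` and
predicates from `P`, the terms of `α` being replaced by their identifiers. -/
noncomputable def canType (X : Set (Atom S T)) (P : Set S.Pred) (α : Atom S T) : IntType S where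
  guard := α.map (ident α.args)
  side := Atom.map (ident α.args) '' ({β ∈ X | β.pred ∈ P ∧ ∀ t ∈ β.args, t ∈ α.args} \ {α})

theorem atoms_canType {X : Set (Atom S T)} {P : Set S.Pred} {α : Atom S T} (hα : α ∈ X)
    (hP : α.pred ∈ P) : (canType X P α).atoms =
      Atom.map (ident α.args) '' {β ∈ X | β.pred ∈ P ∧ ∀ t ∈ β.args, t ∈ α.args} := by
  change insert (Atom.map _ α) (Atom.map _ '' _) = _
  rw [← Set.image_insert_eq, Set.insert_sdiff_singleton, Set.insert_eq_of_mem]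
  exact ⟨hα, hP, fun _ h => h⟩

theorem canType_map {X : Set (Atom S T)} {X' : Set (Atom S T')} {P : Set S.Pred} {α : Atom S T}
    {θ : T → T'} (hθ : Set.InjOn θ {t | t ∈ α.args})
    (h : ∀ β : Atom S T, β.pred ∈ P → (∀ t ∈ β.args, t ∈ α.args) → (β ∈ X ↔ β.map θ ∈ X')) :
    canType X' P (α.map θ) = canType X P α := by
  have hid : ∀ β : Atom S T, (∀ t ∈ β.args, t ∈ α.args) →
      (β.map θ).map (ident (α.map θ).args) = β.map (ident α.args) := by
    intro β hβ
    rw [Atom.map_map]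
    exact Atom.map_congr fun t ht => ident_map hθ (hβ t ht)
  have hinj : ∀ β : Atom S T, (∀ t ∈ β.args, t ∈ α.args) → β.map θ = α.map θ → β = α := by
    intro β hβ e
    have hp : β.pred = α.pred := by
      have := congrArg Atom.pred e
      exact this
    have ha : β.args.map θ = α.args.map θ := by
      have := congrArg Atom.args e
      exact this
    ext1
    · exact hp
    · refine List.ext_getElem ?_ fun i hi hi' => ?_
      · have := congrArg List.length ha; simpa using this
      · have : (β.args.map θ)[i]'(by simpa) = (α.args.map θ)[i]'(by simpa) := by simp only [ha]
        rw [List.getElem_map, List.getElem_map] at this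
        exact hθ (hβ _ (List.getElem_mem hi)) (List.getElem_mem hi') this
  unfold canType
  rw [hid α fun _ h => h]
  congr 1
  ext γ
  constructor
  · rintro ⟨β', ⟨⟨hX, hP, hargs⟩, hne⟩, rfl⟩
    obtain ⟨β, hβ, rfl⟩ := Atom.exists_map_eq (f := θ) (P := (· ∈ α.args)) β'
      fun t ht => Atom.mem_args_map.1 (hargs t ht)
    exact ⟨β, ⟨⟨(h β hP hβ).2 hX, hP, hβ⟩, fun e => hne (congrArg (Atom.map θ) e)⟩, (hid β hβ).symm⟩
  · rintro ⟨β, ⟨⟨hX, hP, hβ⟩, hne⟩, rfl⟩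
    refine ⟨β.map θ, ⟨⟨(h β hP hβ).1 hX, hP, ?_⟩, fun e => hne (hinj β hβ e)⟩, hid β hβ⟩
    intro t ht
    obtain ⟨s, hs, rfl⟩ := Atom.mem_args_map.1 ht
    exact List.mem_map_of_mem (hβ s hs)

theorem isType_canType (Γ : Set (TGD S V)) (X : Set (Atom S T)) {α : Atom S T}
    (hα : α.pred ∈ sch Γ) : IsType Γ (canType X (sch Γ) α) := by
  refine ⟨hα, isCanonical_identTuple α.args, ?_⟩
  rintro _ ⟨β, ⟨⟨-, hP, hβ⟩, hne⟩, rfl⟩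
  refine ⟨hP, ?_, fun e => hne ?_⟩
  · intro t ht
    obtain ⟨s, hs, rfl⟩ := Atom.mem_args_map.1 ht
    exact List.mem_map_of_mem (hβ s hs)
  · obtain ⟨d, -⟩ := α.exists_mem_args
    have h1 : ∀ γ : Atom S T, (∀ t ∈ γ.args, t ∈ α.args) →
        (γ.map (ident α.args)).map (entry α.args d) = γ := fun γ hγ => by
      rw [Atom.map_map]
      exact Atom.map_eq_self fun t ht => entry_ident d (hγ t ht)
    have h2 : (β.map (ident α.args)).map (entry α.args d) =
        (α.map (ident α.args)).map (entry α.args d) := congrArg _ e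
    rwa [h1 β hβ, h1 α fun _ h => h] at h2

/-- A canonical tuple of integers is determined by its equality pattern, so a type that
instantiates to the type of `α` is the canonical type of `α`. -/
theorem eq_canType_of_inst_eq {Γ : Set (TGD S V)} {X : Set (Atom S T)} {α : Atom S T}
    (hα : α.pred ∈ sch Γ) (hX : α ∈ X) {τ : IntType S} (hτ : IsType Γ τ)
    (hpred : τ.guard.pred = α.pred) (hpat : identTuple τ.guard.args = identTuple α.args)
    (hinst : τ.inst α.args = {β ∈ X | β.pred ∈ sch Γ ∧ ∀ t ∈ β.args, t ∈ α.args}) :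
    τ = canType X (sch Γ) α := by
  have hcan : IsCanonical τ.guard.args := hτ.2.1
  have hargs : τ.guard.args = identTuple α.args := hcan.identTuple_eq.symm.trans hpat
  have hguard : τ.guard = α.map (ident α.args) := by
    ext1
    · exact hpred
    · exact hargs
  have hatoms : τ.atoms = (canType X (sch Γ) α).atoms := by
    obtain ⟨d, -⟩ := α.exists_mem_args
    have hτargs : ∀ γ ∈ τ.atoms, ∀ k ∈ γ.args, k ∈ τ.guard.args := by
      rintro γ (rfl | hγ)
      · exact fun _ h => h
      · exact (hτ.2.2 γ hγ).2.1
    have hback : ∀ r : ℕ → T, τ.guard.args.map r = α.args → ∀ γ ∈ τ.atoms,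
        (γ.map r).map (ident α.args) = γ := by
      intro r hr γ hγ
      rw [Atom.map_map]
      refine Atom.map_eq_self fun k hk => ?_
      have hk := hτargs γ hγ k hk
      have hinj : Set.InjOn r {k | k ∈ τ.guard.args} := by
        intro u hu v hv e
        have := map_eq_map_iff_of_identTuple_eq (f := id) (g := r) (l := τ.guard.args)
          (by rw [List.map_id, hr, hpat]) hu hv
        exact this.2 e
      rw [Function.comp_apply, ← hr, ident_map hinj hk, hcan.ident_eq hk]
    rw [atoms_canType hX hα, ← hinst]
    ext γ
    constructor
    · intro hγ
      have hr : τ.guard.args.map (entry α.args d) = α.args := by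
        rw [hargs, map_entry_identTuple]
      exact ⟨γ.map (entry α.args d), ⟨_, hr, γ, hγ, rfl⟩, hback _ hr γ hγ⟩
    · rintro ⟨_, ⟨r, hr, γ, hγ, rfl⟩, rfl⟩
      rwa [hback r hr γ hγ]
  have hside : ∀ τ' : IntType S, IsType Γ τ' → τ'.side = τ'.atoms \ {τ'.guard} := by
    intro τ' h'
    unfold IntType.atoms
    rw [Set.insert_sdiff_of_mem _ (Set.mem_singleton _), Set.sdiff_singleton_eq_self]
    exact fun h => (h'.2.2 _ h).2.2 rfl
  have h1 := hside τ hτ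
  have h2 := hside _ (isType_canType Γ X hα)
  have hg : τ.guard = (canType X (sch Γ) α).guard := hguard
  rw [hatoms, hg, ← h2] at h1
  cases τ
  cases hg
  cases h1
  rfl

theorem inst_canType {X : Set (Atom S T)} {P : Set S.Pred} {α : Atom S T} (hα : α ∈ X)
    (hP : α.pred ∈ P) : (canType X P α).inst α.args =
      {β ∈ X | β.pred ∈ P ∧ ∀ t ∈ β.args, t ∈ α.args} := by
  obtain ⟨d, -⟩ := α.exists_mem_args
  ext γ
  unfold IntType.inst
  rw [atoms_canType hα hP]
  constructor
  · rintro ⟨r, hr, _, ⟨β, hβ, rfl⟩, rfl⟩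
    have hr' : ∀ t ∈ α.args, r (ident α.args t) = t := by
      have : (α.args.map (ident α.args)).map r = α.args.map id := by rw [List.map_id]; exact hr
      rw [List.map_map] at this
      exact List.map_inj_left.1 this
    rw [Atom.map_map, Atom.map_eq_self (f := r ∘ ident α.args) fun t ht => hr' t (hβ.2.2 t ht)]
    exact hβ
  · intro hγ
    refine ⟨entry α.args d, map_entry_identTuple _ _, _, ⟨γ, hγ, rfl⟩, ?_⟩
    rw [Atom.map_map]
    exact (Atom.map_eq_self fun t ht => entry_ident d (hγ.2.2 t ht)).symm

end Types

/-! ### Homomorphisms and the atoms below a trigger -/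

section Below

variable {S : Signature} {C C' V : Type*}

/-- The extension of a map on constants to all terms. -/
def GTerm.bind (f : C → GTerm S C' V) : GTerm S C V → GTerm S C' V
  | .const c => f c
  | .null σ h x => .null σ (fun y => (h y).bind f) x

theorem headSubst_bind (f : C → GTerm S C' V) (σ : TGD S V) (h : V → GTerm S C V) (x : V) :
    (headSubst σ h x).bind f = headSubst σ (fun v => (h v).bind f) x := by
  unfold headSubst
  split_ifs
  · rfl
  · rfl

/-- A map on constants that sends the database into a chase sends its chase into that chase. -/
theorem chase_bind {D : Set (Atom S C)} {D' : Set (Atom S C')} {Γ : Set (TGD S V)}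
    {f : C → GTerm S C' V} (hf : ∀ a ∈ D, a.map f ∈ chase D' Γ) {γ : Atom S (GTerm S C V)}
    (hγ : γ ∈ chase D Γ) : γ.map (GTerm.bind f) ∈ chase D' Γ := by
  induction hγ with
  | base a ha => rw [Atom.map_map]; exact hf a ha
  | step σ hσ h hb β hβ ih =>
    obtain ⟨a, ha, rfl⟩ := hβ
    refine InChase.step σ hσ (fun v => (h v).bind f) (fun b hb => ?_) _ ⟨a, ha, ?_⟩
    · have := ih b hb
      rw [Atom.map_map] at this
      exact this
    · rw [Atom.map_map]
      exact Atom.map_congr fun t _ => headSubst_bind f σ h t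

/-- `u` is one of the terms that the name of the null `t` is built from. -/
inductive GTerm.Child : GTerm S C V → GTerm S C V → Prop
  | intro (σ : TGD S V) (h : {x // x ∈ σ.frontier} → GTerm S C V) (x : V) (y) :
      GTerm.Child (h y) (.null σ h x)

theorem GTerm.wellFounded_child : WellFounded (GTerm.Child (S := S) (C := C) (V := V)) := by
  refine ⟨fun t => ?_⟩
  induction t with
  | const c => exact ⟨_, fun u hu => by cases hu⟩
  | null σ h x ih => exact ⟨_, fun u hu => by cases hu; exact ih _⟩

/-- The term `t` is, or is built from, a null that is named by `σ` and `φ`. -/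
inductive Below (σ : TGD S V) (φ : {x // x ∈ σ.frontier} → GTerm S C V) : GTerm S C V → Prop
  | self (z : V) : Below σ φ (.null σ φ z)
  | child {t u : GTerm S C V} (h : GTerm.Child u t) (hu : Below σ φ u) : Below σ φ t

theorem Below.transGen {σ : TGD S V} {φ : {x // x ∈ σ.frontier} → GTerm S C V} {t : GTerm S C V}
    (h : Below σ φ t) (y) : Relation.TransGen GTerm.Child (φ y) t := by
  induction h with
  | self z => exact .single (.intro σ φ z y)
  | child h _ ih => exact ih.tail h

theorem not_below_frontier {σ : TGD S V} {φ : {x // x ∈ σ.frontier} → GTerm S C V} (y) :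
    ¬ Below σ φ (φ y) := fun h =>
  (GTerm.wellFounded_child.transGen.irrefl).irrefl _ (h.transGen y)

/-- A null of a trigger is not one of its frontier values, as its name contains them. -/
theorem headSubst_ne_headSubst {σ : TGD S V} (h : V → GTerm S C V) {v w : V}
    (hv : v ∈ σ.frontier) (hw : w ∉ σ.frontier) : headSubst σ h v ≠ headSubst σ h w := by
  intro e
  rw [headSubst_of_mem hv, headSubst_of_not_mem hw] at e
  refine not_below_frontier (σ := σ) (φ := fun y => h y.1) ⟨v, hv⟩ ?_
  change Below σ _ (h v)
  rw [e]
  exact .self w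

open Classical in
/-- The renaming of the terms below the nulls named by `σ` and `φ`: the frontier values become
integer constants, the nulls `⊥^z_{σ,φ}` become the constants `z`, and the terms built from them
are renamed accordingly. -/
noncomputable def rename (σ : TGD S V) (φ : {x // x ∈ σ.frontier} → GTerm S C V)
    (idx : GTerm S C V → ℕ) : GTerm S C V → GTerm S (ℕ ⊕ V) V
  | .const c => .const (Sum.inl (idx (.const c)))
  | .null σ' h x =>
    if ∃ y, φ y = .null σ' h x then .const (Sum.inl (idx (.null σ' h x)))
    else if GTerm.null σ' h x = .null σ φ x then .const (Sum.inr x)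
    else .null σ' (fun y => rename σ φ idx (h y)) x

theorem rename_frontier (σ : TGD S V) (φ : {x // x ∈ σ.frontier} → GTerm S C V)
    (idx : GTerm S C V → ℕ) (y) : rename σ φ idx (φ y) = .const (Sum.inl (idx (φ y))) := by
  generalize hu : φ y = u
  cases u with
  | const c => rfl
  | null σ' h x => rw [rename, if_pos ⟨y, hu⟩]

theorem rename_null (σ : TGD S V) (φ : {x // x ∈ σ.frontier} → GTerm S C V)
    (idx : GTerm S C V → ℕ) (z : V) :
    rename σ φ idx (.null σ φ z) = .const (Sum.inr z) := by
  rw [rename, if_neg, if_pos rfl]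
  rintro ⟨y, hy⟩
  exact not_below_frontier y (hy ▸ Below.self z)

theorem rename_below {σ : TGD S V} {φ : {x // x ∈ σ.frontier} → GTerm S C V}
    (idx : GTerm S C V → ℕ) {σ' : TGD S V} {h : {x // x ∈ σ'.frontier} → GTerm S C V} {x : V}
    (hb : Below σ φ (.null σ' h x)) (hne : GTerm.null σ' h x ≠ .null σ φ x) :
    rename σ φ idx (.null σ' h x) = .null σ' (fun y => rename σ φ idx (h y)) x := by
  rw [rename, if_neg, if_neg hne]
  rintro ⟨y, hy⟩
  exact not_below_frontier y (hy ▸ hb)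

theorem GTerm.null_eq_null_of_eq {σ σ' : TGD S V} {φ : {x // x ∈ σ.frontier} → GTerm S C V}
    {φ' : {x // x ∈ σ'.frontier} → GTerm S C V} {x x' : V}
    (h : GTerm.null σ φ x = .null σ' φ' x') (y : V) : GTerm.null σ φ y = .null σ' φ' y := by
  cases h; rfl

theorem TGD.guard?_spec {σ : TGD S V} {g : Atom S V} (h : σ.guard? = some g) :
    g ∈ σ.body ∧ σ.Guards g := by
  unfold TGD.guard? at h
  exact ⟨List.mem_of_find?_eq_some h, by simpa using List.find?_some h⟩

theorem TGD.IsGuarded.exists_guard {σ : TGD S V} (h : σ.IsGuarded) :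
    ∃ g, σ.guard? = some g := by
  classical
  obtain ⟨a, ha, hg⟩ := h
  unfold TGD.guard?
  rw [← Option.isSome_iff_exists, List.find?_isSome]
  exact ⟨a, ha, by simpa using hg⟩

theorem pred_mem_sch_of_body {Γ : Set (TGD S V)} {σ : TGD S V} (hσ : σ ∈ Γ) {a : Atom S V}
    (ha : a ∈ σ.body) : a.pred ∈ sch Γ := ⟨a, ⟨σ, hσ, Or.inl ha⟩, rfl⟩

theorem pred_mem_sch_of_head {Γ : Set (TGD S V)} {σ : TGD S V} (hσ : σ ∈ Γ) {a : Atom S V}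
    (ha : a ∈ σ.head) : a.pred ∈ sch Γ := ⟨a, ⟨σ, hσ, Or.inr ha⟩, rfl⟩

/-- The locality of the guarded chase. Let `I` contain the renamings of the result of `(σ, h₀)` and
of the atoms of the chase over its frontier values. Then every atom of the chase with a term below
the nulls of `(σ, h₀)` mentions, apart from such terms, only frontier values, and its renaming
belongs to the chase of `I`. -/
theorem rename_mem_chase {D : Set (Atom S C)} {Γ : Set (TGD S V)} (hΓ : ∀ σ ∈ Γ, σ.IsGuarded)
    {σ : TGD S V} {h₀ : V → GTerm S C V} {idx : GTerm S C V → ℕ} {I : Set (Atom S (ℕ ⊕ V))}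
    (hres : ∀ β ∈ result σ h₀, β.map (rename σ (fun y => h₀ y.1) idx) ∈ chase I Γ)
    (hfr : ∀ β ∈ chase D Γ, β.pred ∈ sch Γ → (∀ t ∈ β.args, ∃ y ∈ σ.frontier, h₀ y = t) →
      β.map (rename σ (fun y => h₀ y.1) idx) ∈ chase I Γ)
    {γ : Atom S (GTerm S C V)} (hγ : γ ∈ chase D Γ)
    (hbel : ∃ t ∈ γ.args, Below σ (fun y => h₀ y.1) t) :
    (∀ t ∈ γ.args, (∃ y ∈ σ.frontier, h₀ y = t) ∨ Below σ (fun y => h₀ y.1) t) ∧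
      γ.map (rename σ (fun y => h₀ y.1) idx) ∈ chase I Γ := by
  induction hγ with
  | base a ha =>
    obtain ⟨t, ht, hb⟩ := hbel
    obtain ⟨c, -, rfl⟩ := Atom.mem_args_map.1 ht
    cases hb with
    | child h _ => cases h
  | step σ' hσ' h hb β hβ ih =>
    obtain ⟨a, ha, rfl⟩ := hβ
    by_cases hsame : ∃ x, GTerm.null σ' (fun y => h y.1) x = .null σ (fun y => h₀ y.1) x
    · -- the trigger may differ from `(σ, h₀)` outside the frontier, but its result is the same
      obtain ⟨x, hx⟩ := hsame
      have hsub : ∀ v, headSubst σ' h v = headSubst σ h₀ v := by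
        intro v
        rw [headSubst_eq_frontierSubst, headSubst_eq_frontierSubst]
        have hσσ : σ' = σ := (GTerm.null.inj hx).1
        subst hσσ
        have := (GTerm.null.inj hx).2.1
        rw [eq_of_heq this]
      have hσσ : σ' = σ := (GTerm.null.inj hx).1
      subst hσσ
      have hmem : a.map (headSubst σ' h) ∈ result σ' h₀ := ⟨a, ha, Atom.map_congr fun v _ => hsub v⟩
      refine ⟨fun t ht => ?_, hres _ hmem⟩
      obtain ⟨v, hv, rfl⟩ := Atom.mem_args_map.1 ht
      rw [hsub]
      by_cases hvf : v ∈ σ'.frontier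
      · rw [headSubst_of_mem hvf]
        exact Or.inl ⟨v, hvf, rfl⟩
      · rw [headSubst_of_not_mem hvf]
        exact Or.inr (.self v)
    · -- some frontier value of the trigger lies below the nulls of `(σ, h₀)`
      have hfrb : ∃ y ∈ σ'.frontier, Below σ (fun y => h₀ y.1) (h y) := by
        obtain ⟨t, ht, hbt⟩ := hbel
        obtain ⟨v, hv, rfl⟩ := Atom.mem_args_map.1 ht
        by_cases hvf : v ∈ σ'.frontier
        · rw [headSubst_of_mem hvf] at hbt
          exact ⟨v, hvf, hbt⟩
        · rw [headSubst_of_not_mem hvf] at hbt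
          generalize hu : GTerm.null σ' (fun y => h y.1) v = u at hbt
          cases hbt with
          | self z =>
            exact absurd ⟨v, GTerm.null_eq_null_of_eq hu v⟩ hsame
          | child hc hbu =>
            subst hu
            cases hc with
            | intro _ _ _ y => exact ⟨y.1, y.2, hbu⟩
      obtain ⟨y, hy, hby⟩ := hfrb
      obtain ⟨g, hg⟩ := (hΓ σ' hσ').exists_guard
      obtain ⟨hgb, hgg⟩ := TGD.guard?_spec hg
      have hcov := (ih g hgb ⟨h y, List.mem_map_of_mem (hgg y hy.1), hby⟩).1
      have hvar : ∀ v ∈ σ'.bodyVars,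
          (∃ y ∈ σ.frontier, h₀ y = h v) ∨ Below σ (fun y => h₀ y.1) (h v) :=
        fun v hv => hcov _ (List.mem_map_of_mem (hgg v hv))
      constructor
      · intro t ht
        obtain ⟨v, hv, rfl⟩ := Atom.mem_args_map.1 ht
        by_cases hvf : v ∈ σ'.frontier
        · rw [headSubst_of_mem hvf]
          exact hvar v hvf.1
        · rw [headSubst_of_not_mem hvf]
          exact Or.inr (.child (.intro σ' (fun y => h y.1) v ⟨y, hy⟩) hby)
      · refine InChase.step σ' hσ' (fun v => rename σ (fun y => h₀ y.1) idx (h v))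
          (fun b hbb => ?_) _ ⟨a, ha, ?_⟩
        · have hmem : (b.map h).map (rename σ (fun y => h₀ y.1) idx) ∈ chase I Γ := by
            by_cases hbb' : ∃ t ∈ (b.map h).args, Below σ (fun y => h₀ y.1) t
            · exact (ih b hbb hbb').2
            · refine hfr _ (hb b hbb) (pred_mem_sch_of_body hσ' hbb) fun t ht => ?_
              obtain ⟨v, hv, rfl⟩ := Atom.mem_args_map.1 ht
              exact (hvar v ⟨b, hbb, hv⟩).resolve_right fun hn => hbb' ⟨_, ht, hn⟩
          rwa [Atom.map_map] at hmem
        · rw [Atom.map_map]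
          refine Atom.map_congr fun v _ => ?_
          rw [Function.comp_apply]
          by_cases hvf : v ∈ σ'.frontier
          · rw [headSubst_of_mem hvf, headSubst_of_mem hvf]
          · rw [headSubst_of_not_mem hvf, headSubst_of_not_mem hvf]
            exact rename_below idx (.child (.intro σ' (fun y => h y.1) v ⟨y, hy⟩) hby)
              fun e => hsame ⟨v, e⟩

theorem pred_mem_sch_of_mem_chase {D : Set (Atom S C)} {Γ : Set (TGD S V)}
    (hD : ∀ a ∈ D, a.pred ∈ sch Γ) {γ : Atom S (GTerm S C V)} (hγ : γ ∈ chase D Γ) :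
    γ.pred ∈ sch Γ := by
  induction hγ with
  | base a ha => exact hD a ha
  | step σ hσ h hb β hβ ih =>
    obtain ⟨a, ha, rfl⟩ := hβ
    exact pred_mem_sch_of_head hσ ha

/-- The type of an atom produced by a trigger is determined by the TGD and the type of the image
of its guard: it is the type that the linearization attaches to the head atom. -/
theorem linHeadType_eq {D : Set (Atom S C)} {Γ : Set (TGD S V)} (hΓ : ∀ σ ∈ Γ, σ.IsGuarded)
    {σ : TGD S V} (hσ : σ ∈ Γ) {g : Atom S V} (hg : σ.guard? = some g) {h' : V → GTerm S C V}
    (hb : ∀ b ∈ σ.body, b.map h' ∈ chase D Γ) {h : V → ℕ}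
    (hh : ∀ v ∈ g.args, h v = ident (g.map h').args (h' v)) {a : Atom S V} (ha : a ∈ σ.head) :
    linHeadType Γ σ (canType (chase D Γ) (sch Γ) (g.map h')) h a =
      canType (chase D Γ) (sch Γ) (a.map (headSubst σ h')) := by
  obtain ⟨hgb, hgg⟩ := TGD.guard?_spec hg
  set α := g.map h' with hα
  set τ := canType (chase D Γ) (sch Γ) α with hτ
  have hτatoms : τ.atoms = _ := atoms_canType (hb g hgb) (pred_mem_sch_of_body hσ hgb)
  have hmemα : ∀ v ∈ σ.frontier, h' v ∈ α.args := fun v hv => List.mem_map_of_mem (hgg v hv.1)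
  have hhf : ∀ v ∈ σ.frontier, h v = ident α.args (h' v) := fun v hv => hh v (hgg v hv.1)
  obtain ⟨d, -⟩ := α.exists_mem_args
  let θ : ℕ ⊕ V → GTerm S C V :=
    Sum.elim (entry α.args d) (fun z => .null σ (fun y => h' y.1) z)
  have hθ : ∀ v, θ (linSubst σ h v) = headSubst σ h' v := by
    intro v
    unfold linSubst
    split_ifs with hv
    · rw [headSubst_of_mem hv, hhf v hv]
      exact entry_ident d (hmemα v hv)
    · rw [headSubst_of_not_mem hv]
      rfl
  have hθinj : Set.InjOn θ {t | t ∈ (a.map (linSubst σ h)).args} := by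
    rintro _ ht _ hu e
    obtain ⟨v, hv, rfl⟩ := Atom.mem_args_map.1 ht
    obtain ⟨w, hw, rfl⟩ := Atom.mem_args_map.1 hu
    rw [hθ, hθ] at e
    by_cases hvf : v ∈ σ.frontier <;> by_cases hwf : w ∈ σ.frontier
    · rw [headSubst_of_mem hvf, headSubst_of_mem hwf] at e
      rw [linSubst, linSubst, if_pos hvf, if_pos hwf, hhf v hvf, hhf w hwf, e]
    · exact absurd e (headSubst_ne_headSubst h' hvf hwf)
    · exact absurd e.symm (headSubst_ne_headSubst h' hwf hvf)
    · rw [headSubst_of_not_mem hvf, headSubst_of_not_mem hwf] at e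
      rw [(GTerm.null.inj e).2.2]
  have hI : ∀ b ∈ linInst σ τ h, b.pred ∈ sch Γ ∧ b.map θ ∈ chase D Γ := by
    rintro b (⟨a', ha', rfl⟩ | ⟨γ, hγ, rfl⟩)
    · refine ⟨pred_mem_sch_of_head hσ ha', InChase.step σ hσ h' hb _ ⟨a', ha', ?_⟩⟩
      rw [Atom.map_map]
      exact Atom.map_congr fun v _ => hθ v
    · rw [hτatoms] at hγ
      obtain ⟨β, ⟨hβ, hP, hβα⟩, rfl⟩ := hγ
      refine ⟨hP, ?_⟩
      rw [Atom.map_map, Atom.map_map, Atom.map_eq_self]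
      · exact hβ
      · exact fun t ht => entry_ident d (hβα t ht)
  have hrename : ∀ v, rename σ (fun y => h' y.1) (ident α.args) (headSubst σ h' v) =
      .const (linSubst σ h v) := by
    intro v
    by_cases hv : v ∈ σ.frontier
    · rw [headSubst_of_mem hv, linSubst, if_pos hv, hhf v hv]
      exact rename_frontier σ (fun y => h' y.1) _ ⟨v, hv⟩
    · rw [headSubst_of_not_mem hv, linSubst, if_neg hv, rename_null]
  have hhead : a.map (linSubst σ h) ∈ linInst σ τ h := Or.inl ⟨a, ha, rfl⟩
  have key : ∀ β : Atom S (ℕ ⊕ V), β.pred ∈ sch Γ →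
      (∀ t ∈ β.args, t ∈ (a.map (linSubst σ h)).args) →
      (β ∈ completion (linInst σ τ h) Γ ↔ β.map θ ∈ chase D Γ) := by
    intro β hβP hβ
    constructor
    · -- `θ` maps the instance of the linearization into the chase, hence also its chase
      rintro ⟨hβc, -⟩
      have := chase_bind (f := θ) (fun b hb => (hI b hb).2) hβc
      rwa [Atom.map_map] at this
    · -- conversely, the locality of the chase applies to the renaming that inverts `θ`
      intro hβc
      refine ⟨?_, fun t ht => ⟨_, hhead, hβ t ht⟩⟩
      have hback : (β.map θ).map (rename σ (fun y => h' y.1) (ident α.args)) =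
          β.map GTerm.const := by
        rw [Atom.map_map]
        refine Atom.map_congr fun t ht => ?_
        obtain ⟨v, -, rfl⟩ := Atom.mem_args_map.1 (hβ t ht)
        rw [Function.comp_apply, hθ, hrename]
      have hfr : ∀ β ∈ chase D Γ, β.pred ∈ sch Γ →
          (∀ t ∈ β.args, ∃ y ∈ σ.frontier, h' y = t) →
          β.map (rename σ (fun y => h' y.1) (ident α.args)) ∈ chase (linInst σ τ h) Γ := by
        intro β hβ hP hargs
        have hβα : ∀ t ∈ β.args, t ∈ α.args := by
          intro t ht
          obtain ⟨y, hy, rfl⟩ := hargs t ht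
          exact hmemα y hy
        have : β.map (rename σ (fun y => h' y.1) (ident α.args)) =
            ((β.map (ident α.args)).map Sum.inl).map GTerm.const := by
          rw [Atom.map_map, Atom.map_map]
          refine Atom.map_congr fun t ht => ?_
          obtain ⟨y, hy, rfl⟩ := hargs t ht
          exact rename_frontier σ (fun y => h' y.1) _ ⟨y, hy⟩
        rw [this]
        refine InChase.base _ (Or.inr ⟨_, ?_, rfl⟩)
        rw [hτatoms]
        exact ⟨β, ⟨hβ, hP, hβα⟩, rfl⟩
      change β.map GTerm.const ∈ chase (linInst σ τ h) Γ
      rw [← hback]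
      by_cases hbel : ∃ t ∈ (β.map θ).args, Below σ (fun y => h' y.1) t
      · refine (rename_mem_chase hΓ ?_ hfr hβc hbel).2
        rintro _ ⟨a', ha', rfl⟩
        have : (a'.map (headSubst σ h')).map (rename σ (fun y => h' y.1) (ident α.args)) =
            (a'.map (linSubst σ h)).map GTerm.const := by
          rw [Atom.map_map, Atom.map_map]
          exact Atom.map_congr fun v _ => hrename v
        rw [this]
        exact InChase.base _ (Or.inl ⟨a', ha', rfl⟩)
      · refine hfr _ hβc hβP fun t ht => ?_
        obtain ⟨s, hs, rfl⟩ := Atom.mem_args_map.1 ht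
        obtain ⟨v, -, rfl⟩ := Atom.mem_args_map.1 (hβ s hs)
        rw [hθ]
        by_cases hv : v ∈ σ.frontier
        · exact ⟨v, hv, (headSubst_of_mem hv).symm⟩
        · refine absurd ⟨_, ht, ?_⟩ hbel
          rw [hθ, headSubst_of_not_mem hv]
          exact .self v
  have hmap : a.map (headSubst σ h') = (a.map (linSubst σ h)).map θ := by
    rw [Atom.map_map]
    exact Atom.map_congr fun v _ => (hθ v).symm
  rw [hmap, canType_map hθinj key]
  unfold linHeadType canType
  congr 3
  ext β
  constructor
  · rintro ⟨hβ, hargs⟩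
    exact ⟨hβ, pred_mem_sch_of_mem_chase (fun b hb => (hI b hb).1) hβ.1, hargs⟩
  · rintro ⟨hβ, -, hargs⟩
    exact ⟨hβ, hargs⟩

end Below

/-! ### Triggers and simplified linear TGDs -/

section Specializations

variable {V T : Type*}

open Classical in
/-- The specialization of `l` that sends each variable to the first one with the same value. -/
noncomputable def specializationOf (l : List V) (k : V → T) (v : V) : V :=
  if v ∈ l then (l.find? fun u => decide (k u = k v)).getD v else v

theorem specializationOf_spec {l : List V} (k : V → T) {v : V} (hv : v ∈ l) :
    ∃ i, ∃ hi : i < l.length, specializationOf l k v = l[i] ∧ k l[i] = k v ∧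
      ∀ j (hj : j < l.length), k l[j] = k v → i ≤ j := by
  classical
  unfold specializationOf
  rw [if_pos hv]
  cases hf : l.find? fun u => decide (k u = k v) with
  | none =>
    rw [List.find?_eq_none] at hf
    exact absurd (decide_eq_true rfl) (hf v hv)
  | some u =>
    obtain ⟨hu, i, hi, rfl, hmin⟩ := List.find?_eq_some_iff_getElem.1 hf
    refine ⟨i, hi, rfl, by simpa using hu, fun j hj e => ?_⟩
    by_contra hlt
    have := hmin j (not_le.1 hlt)
    simp [e] at this

theorem specializationOf_eq_of_eq {l : List V} {k : V → T} {u v : V} (hu : u ∈ l) (hv : v ∈ l)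
    (e : k u = k v) : specializationOf l k u = specializationOf l k v := by
  obtain ⟨i, hi, h1, h2, h3⟩ := specializationOf_spec k hu
  obtain ⟨j, hj, h1', h2', h3'⟩ := specializationOf_spec k hv
  obtain rfl : i = j := le_antisymm (h3 j hj (h2'.trans e.symm)) (h3' i hi (h2.trans e))
  rw [h1, h1']

theorem apply_specializationOf {l : List V} (k : V → T) {v : V} (hv : v ∈ l) :
    k (specializationOf l k v) = k v := by
  obtain ⟨i, hi, h1, h2, -⟩ := specializationOf_spec k hv
  rw [h1, h2]

theorem isSpecialization_specializationOf (l : List V) (k : V → T) :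
    IsSpecialization l (specializationOf l k) := by
  refine ⟨fun i hi => ?_, fun v hv => if_neg hv⟩
  obtain ⟨j, hj, h1, h2, h3⟩ := specializationOf_spec k (List.getElem_mem hi)
  rcases (h3 i hi rfl).lt_or_eq with hlt | rfl
  · right
    rw [← specializationOf_eq_of_eq (List.getElem_mem hj) (List.getElem_mem hi) h2]
    refine List.mem_map_of_mem (List.mem_take_iff_getElem.2 ⟨j, ?_, rfl⟩)
    omega
  · exact Or.inl h1

theorem IsSpecialization.mem_and_idem {l : List V} {f : V → V} (hf : IsSpecialization l f) {v : V}
    (hv : v ∈ l) : f v ∈ l ∧ f (f v) = f v := by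
  have key : ∀ i (hi : i < l.length), f l[i] ∈ l ∧ f (f l[i]) = f l[i] := by
    intro i
    induction i using Nat.strong_induction_on with
    | _ i ih =>
      intro hi
      rcases hf.1 i hi with h | h
      · rw [h]
        exact ⟨List.getElem_mem hi, h⟩
      · obtain ⟨u, hu, e⟩ := List.mem_map.1 h
        obtain ⟨j, hj, rfl⟩ := List.mem_take_iff_getElem.1 hu
        rw [← e]
        exact ih j (by omega) (by omega)
  obtain ⟨i, hi, rfl⟩ := List.getElem_of_mem hv
  exact key i hi

end Specializations

section Simulation

variable {S : Signature} {C V : Type*}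

/-- The simplified type of an atom: the predicate, in the simplification of the linearization, that
stands for the atoms with the equality pattern and the type of `α`. -/
noncomputable def simpleType (D : Set (Atom S C)) (Γ : Set (TGD S V))
    (α : Atom S (GTerm S C V)) : (simpleSig (linSig S)).Pred where
  base := canType (chase D Γ) (sch Γ) α
  ids := identTuple α.args
  length_ids := by rw [identTuple, List.length_map]; exact α.length_args

/-- `(σ, h)` is a trigger on the chase, `g` is the guard of `σ`, and `f` is the specialization of
the variables of `g` that identifies the same variables as `h`. -/
structure IsGuardTrigger (D : Set (Atom S C)) (Γ : Set (TGD S V)) (σ : TGD S V) (g : Atom S V)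
    (h : V → GTerm S C V) (f : V → V) : Prop where
  mem : σ ∈ Γ
  guard : σ.guard? = some g
  body : ∀ b ∈ σ.body, b.map h ∈ chase D Γ
  spec : IsSpecialization g.args f
  ker : ∀ u ∈ g.args, ∀ v ∈ g.args, f u = f v ↔ h u = h v

/-- `σ'` is the simplified linear TGD that describes the application of the trigger `(σ, h)`: its
predicates are the simplified types of the image of the guard and of the atoms of the result. -/
def Simulates (D : Set (Atom S C)) (Γ : Set (TGD S V)) (σ' : TGD (simpleSig (linSig S)) V)
    (σ : TGD S V) (g : Atom S V) (h : V → GTerm S C V) (f : V → V) : Prop :=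
  (∃ b, σ'.body = [b] ∧ b.pred = simpleType D Γ (g.map h) ∧ b.args = unique (g.args.map f)) ∧
  ∃ c : Atom S V → Atom (simpleSig (linSig S)) V, σ'.head = σ.head.map c ∧
    ∀ a ∈ σ.head, (c a).pred = simpleType D Γ (a.map (headSubst σ h)) ∧
      (c a).args = unique (a.args.map f)

variable {D : Set (Atom S C)} {Γ : Set (TGD S V)} {σ : TGD S V} {g : Atom S V}
  {h : V → GTerm S C V} {f : V → V}

open Classical in
/-- The substitution on the variables of the simplified TGD: `h` on the body, and the nulls of the
trigger on the existential variables. -/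
noncomputable def simpleSubst (σ : TGD S V) (g : Atom S V) (h : V → GTerm S C V) (v : V) :
    GTerm S C V :=
  if v ∈ g.args then h v else GTerm.null σ (fun y => h y.1) v

namespace IsGuardTrigger

theorem guard_mem (T : IsGuardTrigger D Γ σ g h f) : g ∈ σ.body := (TGD.guard?_spec T.guard).1

theorem mem_args_iff (T : IsGuardTrigger D Γ σ g h f) {v : V} : v ∈ g.args ↔ v ∈ σ.bodyVars :=
  ⟨fun hv => ⟨g, T.guard_mem, hv⟩, (TGD.guard?_spec T.guard).2 v⟩

theorem frontier_subset (T : IsGuardTrigger D Γ σ g h f) {v : V} (hv : v ∈ σ.frontier) :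
    v ∈ g.args := T.mem_args_iff.2 hv.1

theorem mem_frontier (T : IsGuardTrigger D Γ σ g h f) {a : Atom S V} (ha : a ∈ σ.head) {v : V}
    (hv : v ∈ a.args) (hvg : v ∈ g.args) : v ∈ σ.frontier :=
  ⟨T.mem_args_iff.1 hvg, a, ha, hv⟩

theorem guard_mem_chase (T : IsGuardTrigger D Γ σ g h f) : g.map h ∈ chase D Γ :=
  T.body g T.guard_mem

theorem pred_guard_mem (T : IsGuardTrigger D Γ σ g h f) : (g.map h).pred ∈ sch Γ :=
  pred_mem_sch_of_body T.mem T.guard_mem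

theorem head_mem_chase (T : IsGuardTrigger D Γ σ g h f) {a : Atom S V} (ha : a ∈ σ.head) :
    a.map (headSubst σ h) ∈ chase D Γ := InChase.step σ T.mem h T.body _ ⟨a, ha, rfl⟩

theorem apply_spec (T : IsGuardTrigger D Γ σ g h f) {v : V} (hv : v ∈ g.args) :
    h (f v) = h v :=
  (T.ker _ (T.spec.mem_and_idem hv).1 v hv).1 (T.spec.mem_and_idem hv).2

theorem guard_args (T : IsGuardTrigger D Γ σ g h f) :
    (g.args.map f).map h = (g.map h).args := by
  rw [List.map_map]
  exact List.map_congr_left fun v hv => T.apply_spec hv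

theorem injOn_guard (T : IsGuardTrigger D Γ σ g h f) :
    Set.InjOn h {v | v ∈ g.args.map f} := by
  intro u hu v hv e
  obtain ⟨u, hu', rfl⟩ := List.mem_map.1 hu
  obtain ⟨v, hv', rfl⟩ := List.mem_map.1 hv
  rw [T.apply_spec hu', T.apply_spec hv'] at e
  exact (T.ker u hu' v hv').2 e

theorem unique_guard (T : IsGuardTrigger D Γ σ g h f) :
    unique (g.map h).args = (unique (g.args.map f)).map h := by
  rw [← T.guard_args, unique_map T.injOn_guard]

theorem identTuple_guard (T : IsGuardTrigger D Γ σ g h f) :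
    identTuple (g.args.map f) = identTuple (g.map h).args := by
  rw [← T.guard_args, identTuple_map T.injOn_guard]

theorem simpleSubst_spec (T : IsGuardTrigger D Γ σ g h f) {a : Atom S V} (ha : a ∈ σ.head) {v : V}
    (hv : v ∈ a.args) : simpleSubst σ g h (f v) = headSubst σ h v := by
  by_cases hvg : v ∈ g.args
  · rw [headSubst_of_mem (T.mem_frontier ha hv hvg), simpleSubst,
      if_pos (T.spec.mem_and_idem hvg).1, T.apply_spec hvg]
  · rw [headSubst_of_not_mem fun hvf => hvg (T.frontier_subset hvf), T.spec.2 v hvg, simpleSubst,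
      if_neg hvg]

theorem head_args (T : IsGuardTrigger D Γ σ g h f) {a : Atom S V} (ha : a ∈ σ.head) :
    (a.args.map f).map (simpleSubst σ g h) = (a.map (headSubst σ h)).args := by
  rw [List.map_map]
  exact List.map_congr_left fun v hv => T.simpleSubst_spec ha hv

/-- The guard may contain a null of the trigger itself, when another trigger with the same frontier
values produced it; but such a null is not a frontier value, so it does not occur in a head atom at
the place of a body variable. -/
theorem injOn_head (T : IsGuardTrigger D Γ σ g h f) {a : Atom S V} (ha : a ∈ σ.head) :
    Set.InjOn (simpleSubst σ g h) {v | v ∈ a.args.map f} := by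
  intro u hu v hv e
  obtain ⟨u, hu', rfl⟩ := List.mem_map.1 hu
  obtain ⟨v, hv', rfl⟩ := List.mem_map.1 hv
  rw [T.simpleSubst_spec ha hu', T.simpleSubst_spec ha hv'] at e
  by_cases huf : u ∈ σ.frontier <;> by_cases hvf : v ∈ σ.frontier
  · rw [headSubst_of_mem huf, headSubst_of_mem hvf] at e
    exact (T.ker u (T.frontier_subset huf) v (T.frontier_subset hvf)).2 e
  · exact absurd e (headSubst_ne_headSubst h huf hvf)
  · exact absurd e.symm (headSubst_ne_headSubst h hvf huf)
  · rw [headSubst_of_not_mem huf, headSubst_of_not_mem hvf] at e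
    rw [(GTerm.null.inj e).2.2]

theorem unique_head (T : IsGuardTrigger D Γ σ g h f) {a : Atom S V} (ha : a ∈ σ.head) :
    unique (a.map (headSubst σ h)).args = (unique (a.args.map f)).map (simpleSubst σ g h) := by
  rw [← T.head_args ha, unique_map (T.injOn_head ha)]

theorem identTuple_head (T : IsGuardTrigger D Γ σ g h f) {a : Atom S V} (ha : a ∈ σ.head) :
    identTuple (a.args.map f) = identTuple (a.map (headSubst σ h)).args := by
  rw [← T.head_args ha, identTuple_map (T.injOn_head ha)]

end IsGuardTrigger

theorem SimplePred.ext' {S : Signature} {p q : SimplePred S} (h1 : p.base = q.base)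
    (h2 : p.ids = q.ids) : p = q := by
  cases p; cases q; cases h1; cases h2; rfl

theorem IsGuardTrigger.simulates (T : IsGuardTrigger D Γ σ g h f) (hΓ : ∀ σ ∈ Γ, σ.IsGuarded)
    {k : V → ℕ} (hk : ∀ v ∈ g.args, k v = ident (g.map h).args (h v))
    (hg : g.map k = (canType (chase D Γ) (sch Γ) (g.map h)).guard) :
    Simulates D Γ (simpleTGD (linTGD Γ σ g (canType (chase D Γ) (sch Γ) (g.map h)) k hg) f)
      σ g h f := by
  refine ⟨⟨_, rfl, ?_, rfl⟩, _, List.map_map, fun a ha => ⟨?_, rfl⟩⟩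
  · exact SimplePred.ext' rfl T.identTuple_guard
  · exact SimplePred.ext' (linHeadType_eq hΓ T.mem T.guard T.body hk ha) (T.identTuple_head ha)

/-- Every trigger on the chase is described by a TGD of the simplified linearization. -/
theorem exists_simulates (hΓ : ∀ σ ∈ Γ, σ.IsGuarded) (hσ : σ ∈ Γ)
    (hb : ∀ b ∈ σ.body, b.map h ∈ chase D Γ) :
    ∃ g f, IsGuardTrigger D Γ σ g h f ∧
      ∃ σ' ∈ simpleTGDs (linTGDs Γ), Simulates D Γ σ' σ g h f := by
  obtain ⟨g, hg⟩ := (hΓ σ hσ).exists_guard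
  obtain ⟨hgb, hgg⟩ := TGD.guard?_spec hg
  have T : IsGuardTrigger D Γ σ g h (specializationOf g.args h) := by
    refine ⟨hσ, hg, hb, isSpecialization_specializationOf _ _, fun u hu v hv => ⟨fun e => ?_, ?_⟩⟩
    · rw [← apply_specializationOf h hu, ← apply_specializationOf h hv, e]
    · exact specializationOf_eq_of_eq hu hv
  have hmap : ∀ b : Atom S V, b.map (fun v => ident (g.map h).args (h v)) =
      (b.map h).map (ident (g.map h).args) := fun b =>
    (Atom.map_map b h (ident (g.map h).args)).symm
  refine ⟨g, _, T, _, ⟨_, ⟨σ, hσ, g, hg, canType (chase D Γ) (sch Γ) (g.map h), ?_,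
    fun v => ident (g.map h).args (h v), ?_, hmap g, rfl⟩, _, rfl, _, T.spec, rfl⟩,
    T.simulates hΓ (fun _ _ => rfl) _⟩
  · exact isType_canType Γ _ T.pred_guard_mem
  · intro b hbb
    rw [atoms_canType T.guard_mem_chase T.pred_guard_mem, hmap]
    refine ⟨b.map h, ⟨hb b hbb, pred_mem_sch_of_body hσ hbb, fun t ht => ?_⟩, rfl⟩
    obtain ⟨v, hv, rfl⟩ := Atom.mem_args_map.1 ht
    exact List.mem_map_of_mem (hgg v ⟨b, hbb, hv⟩)

/-- Every TGD of the simplified linearization whose body predicate is the simplified type of an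
atom `α` of the chase describes a trigger that maps the guard to `α`. -/
theorem exists_isGuardTrigger (hΓ : ∀ σ ∈ Γ, σ.IsGuarded)
    {σ' : TGD (simpleSig (linSig S)) V} (hσ' : σ' ∈ simpleTGDs (linTGDs Γ))
    {b : Atom (simpleSig (linSig S)) V} (hb : b ∈ σ'.body) {α : Atom S (GTerm S C V)}
    (hα : α ∈ chase D Γ) (hbα : b.pred = simpleType D Γ α) :
    ∃ σ g h f, IsGuardTrigger D Γ σ g h f ∧ g.map h = α ∧ Simulates D Γ σ' σ g h f := by
  obtain ⟨_, ⟨σ, hσ, g, hg, τ, hτ, k, hk, hgk, rfl⟩, _, hbody, f, hf, rfl⟩ := hσ'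
  obtain rfl := (List.cons.inj hbody).1
  obtain rfl : b = _ := List.mem_singleton.1 hb
  obtain ⟨hgb, hgg⟩ := TGD.guard?_spec hg
  have hbase : τ = canType (chase D Γ) (sch Γ) α := congrArg SimplePred.base hbα
  have hids : identTuple (g.args.map f) = identTuple α.args := congrArg SimplePred.ids hbα
  subst hbase
  have hP : α.pred ∈ sch Γ := hτ.1
  obtain ⟨d, -⟩ := α.exists_mem_args
  let h : V → GTerm S C V := fun v => entry α.args d (k v)
  have hgα : g.map h = α := by
    have : g.map h = (g.map k).map (entry α.args d) := (Atom.map_map g k (entry α.args d)).symm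
    rw [this, hgk]
    change (α.map (ident α.args)).map (entry α.args d) = α
    rw [Atom.map_map]
    exact Atom.map_eq_self fun t ht => entry_ident d ht
  have hkh : ∀ v ∈ g.args, k v = ident α.args (h v) := by
    intro v hv
    have : k v ∈ (g.map k).args := List.mem_map_of_mem hv
    rw [hgk] at this
    obtain ⟨t, ht, e⟩ := List.mem_map.1 (show k v ∈ α.args.map (ident α.args) from this)
    simp only [h]
    rw [← e, entry_ident d ht]
  have T : IsGuardTrigger D Γ σ g h f := by
    refine ⟨hσ, hg, fun b hb => ?_, hf, fun u hu v hv => ?_⟩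
    · have hbk := hk b hb
      rw [atoms_canType hα hP] at hbk
      obtain ⟨β, ⟨hβ, -, hβα⟩, e⟩ := hbk
      have : b.map h = (b.map k).map (entry α.args d) := (Atom.map_map b k (entry α.args d)).symm
      rw [this, ← e, Atom.map_map, Atom.map_eq_self]
      · exact hβ
      · exact fun t ht => entry_ident d (hβα t ht)
    · refine map_eq_map_iff_of_identTuple_eq (hids.trans ?_) hu hv
      rw [← hgα]
      rfl
  refine ⟨σ, g, h, f, T, hgα, ?_⟩
  clear_value h
  subst hgα
  exact T.simulates hΓ hkh hgk

/-! ### Paths in the dependency graph and terms of the chase -/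

/-- The node of the dependency graph that stands for the occurrence of `t` in `α`. -/
def AtNode (D : Set (Atom S C)) (Γ : Set (TGD S V)) (α : Atom S (GTerm S C V)) (t : GTerm S C V)
    (v : (simpleSig (linSig S)).Pred × ℕ) : Prop :=
  v.1 = simpleType D Γ α ∧ (unique α.args)[v.2]? = some t

theorem exists_atNode (D : Set (Atom S C)) (Γ : Set (TGD S V)) {α : Atom S (GTerm S C V)}
    {t : GTerm S C V} (ht : t ∈ α.args) : ∃ v, AtNode D Γ α t v :=
  ⟨(simpleType D Γ α, ident α.args t - 1), rfl, unique_getElem?_ident ht⟩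

theorem exists_of_getElem?_map {T T' : Type*} {l : List T} {k : T → T'} {i : ℕ} {t : T'}
    (h : (l.map k)[i]? = some t) : ∃ x, l[i]? = some x ∧ k x = t := by
  rw [List.getElem?_map] at h
  exact Option.map_eq_some_iff.1 h

section Edges

variable {σ' : TGD (simpleSig (linSig S)) V} {a : Atom S V}

theorem IsGuardTrigger.occursAt_body (T : IsGuardTrigger D Γ σ g h f)
    (hs : Simulates D Γ σ' σ g h f) {v : V} (hv : v ∈ g.args)
    {p : (simpleSig (linSig S)).Pred × ℕ} (hp : AtNode D Γ (g.map h) (h v) p) :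
    OccursAt σ'.body (f v) p := by
  obtain ⟨⟨b, hb, hbp, hba⟩, -⟩ := hs
  refine ⟨b, by rw [hb]; exact List.mem_singleton_self _, hbp.trans hp.1.symm, ?_⟩
  have h2 := hp.2
  rw [T.unique_guard] at h2
  obtain ⟨x, hx, e⟩ := exists_of_getElem?_map h2
  have hxm : x ∈ g.args.map f := mem_unique.1 (List.mem_of_getElem? hx)
  rw [← T.apply_spec hv] at e
  rw [hba, hx, T.injOn_guard hxm (List.mem_map_of_mem hv) e]

theorem IsGuardTrigger.occursAt_head (T : IsGuardTrigger D Γ σ g h f)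
    (hs : Simulates D Γ σ' σ g h f) (ha : a ∈ σ.head) {v : V} (hv : v ∈ a.args)
    {p : (simpleSig (linSig S)).Pred × ℕ}
    (hp : AtNode D Γ (a.map (headSubst σ h)) (headSubst σ h v) p) :
    OccursAt σ'.head (f v) p := by
  obtain ⟨-, c, hc, hca⟩ := hs
  refine ⟨c a, by rw [hc]; exact List.mem_map_of_mem ha, (hca a ha).1.trans hp.1.symm, ?_⟩
  have h2 := hp.2
  rw [T.unique_head ha] at h2
  obtain ⟨x, hx, e⟩ := exists_of_getElem?_map h2
  have hxm : x ∈ a.args.map f := mem_unique.1 (List.mem_of_getElem? hx)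
  rw [← T.simpleSubst_spec ha hv] at e
  rw [(hca a ha).2, hx, T.injOn_head ha hxm (List.mem_map_of_mem hv) e]

theorem Simulates.mem_bodyVars (hs : Simulates D Γ σ' σ g h f) {x : V} :
    x ∈ σ'.bodyVars ↔ x ∈ g.args.map f := by
  obtain ⟨⟨b, hb, -, hba⟩, -⟩ := hs
  unfold TGD.bodyVars dom
  rw [hb]
  constructor
  · rintro ⟨b', hb', hx⟩
    obtain rfl := List.mem_singleton.1 hb'
    rw [hba] at hx
    exact mem_unique.1 hx
  · intro hx
    exact ⟨b, List.mem_singleton_self _, by rw [hba]; exact mem_unique.2 hx⟩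

theorem Simulates.mem_headVars (hs : Simulates D Γ σ' σ g h f) {x : V} :
    x ∈ σ'.headVars ↔ ∃ a ∈ σ.head, x ∈ a.args.map f := by
  obtain ⟨-, c, hc, hca⟩ := hs
  unfold TGD.headVars dom
  rw [hc]
  constructor
  · rintro ⟨b', hb', hx⟩
    obtain ⟨a, ha, rfl⟩ := List.mem_map.1 hb'
    rw [(hca a ha).2] at hx
    exact ⟨a, ha, mem_unique.1 hx⟩
  · rintro ⟨a, ha, hx⟩
    exact ⟨c a, List.mem_map_of_mem ha, by rw [(hca a ha).2]; exact mem_unique.2 hx⟩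

theorem IsGuardTrigger.mem_frontier_simple (T : IsGuardTrigger D Γ σ g h f)
    (hs : Simulates D Γ σ' σ g h f) {v : V} (hv : v ∈ σ.frontier) : f v ∈ σ'.frontier := by
  refine ⟨hs.mem_bodyVars.2 (List.mem_map_of_mem (T.frontier_subset hv)), hs.mem_headVars.2 ?_⟩
  obtain ⟨a, ha, hva⟩ := hv.2
  exact ⟨a, ha, List.mem_map_of_mem hva⟩

theorem IsGuardTrigger.normal_edge (T : IsGuardTrigger D Γ σ g h f)
    (hσ' : σ' ∈ simpleTGDs (linTGDs Γ)) (hs : Simulates D Γ σ' σ g h f) (ha : a ∈ σ.head) {v : V}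
    (hv : v ∈ a.args) (hvf : v ∈ σ.frontier) {p q : (simpleSig (linSig S)).Pred × ℕ}
    (hp : AtNode D Γ (g.map h) (h v) p) (hq : AtNode D Γ (a.map (headSubst σ h)) (h v) q) :
    DepEdge (simpleTGDs (linTGDs Γ)) false p q := by
  refine ⟨σ', hσ', f v, T.mem_frontier_simple hs hvf, T.occursAt_body hs (T.frontier_subset hvf) hp,
    T.occursAt_head hs ha hv ?_⟩
  rwa [headSubst_of_mem hvf]

theorem IsGuardTrigger.special_edge (T : IsGuardTrigger D Γ σ g h f)
    (hσ' : σ' ∈ simpleTGDs (linTGDs Γ)) (hs : Simulates D Γ σ' σ g h f) (ha : a ∈ σ.head) {v z : V}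
    (hvf : v ∈ σ.frontier) (hz : z ∈ a.args) (hzf : z ∉ σ.frontier)
    {p q : (simpleSig (linSig S)).Pred × ℕ} (hp : AtNode D Γ (g.map h) (h v) p)
    (hq : AtNode D Γ (a.map (headSubst σ h)) (headSubst σ h z) q) :
    DepEdge (simpleTGDs (linTGDs Γ)) true p q := by
  have hzg : z ∉ g.args := fun hzg => hzf (T.mem_frontier ha hz hzg)
  have hfz : f z = z := T.spec.2 z hzg
  refine ⟨σ', hσ', f v, T.mem_frontier_simple hs hvf, T.occursAt_body hs (T.frontier_subset hvf) hp,
    f z, ⟨hs.mem_headVars.2 ⟨a, ha, List.mem_map_of_mem hz⟩, fun hzb => hzg ?_⟩,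
    T.occursAt_head hs ha hz hq⟩
  obtain ⟨u, hu, e⟩ := List.mem_map.1 (hs.mem_bodyVars.1 hzb)
  rw [← hfz, ← e]
  exact (T.spec.mem_and_idem hu).1

theorem Simulates.predStep (hσ' : σ' ∈ simpleTGDs (linTGDs Γ))
    (hs : Simulates D Γ σ' σ g h f) (ha : a ∈ σ.head) :
    PredStep (simpleTGDs (linTGDs Γ)) (simpleType D Γ (g.map h))
      (simpleType D Γ (a.map (headSubst σ h))) := by
  obtain ⟨⟨b, hb, hbp, -⟩, c, hc, hca⟩ := hs
  exact ⟨σ', hσ', ⟨b, by rw [hb]; exact List.mem_singleton_self _, hbp⟩, c a,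
    by rw [hc]; exact List.mem_map_of_mem ha, (hca a ha).1⟩

end Edges

end Simulation

/-! ### Supported special cycles make the chase infinite -/

section Depth

variable {S : Signature} {C V : Type*}

/-- The nesting depth of nulls in `t` is at most `k`; constants have depth `0`, and a null whose
name contains no term has depth `1`. -/
inductive DepthLe : ℕ → GTerm S C V → Prop
  | const (k : ℕ) (c : C) : DepthLe k (.const c)
  | null {k : ℕ} {σ : TGD S V} {h : {x // x ∈ σ.frontier} → GTerm S C V} (x : V)
      (hh : ∀ y, DepthLe k (h y)) : DepthLe (k + 1) (.null σ h x)

theorem DepthLe.mono {k l : ℕ} {t : GTerm S C V} (h : DepthLe k t) (hkl : k ≤ l) :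
    DepthLe l t := by
  induction h generalizing l with
  | const k c => exact .const l c
  | null x hh ih =>
    obtain ⟨l, rfl⟩ : ∃ l', l = l' + 1 := ⟨l - 1, by omega⟩
    exact .null x fun y => ih y (by omega)

theorem exists_depthLe (t : GTerm S C V) : ∃ k, DepthLe k t := by
  induction t with
  | const c => exact ⟨0, .const 0 c⟩
  | null σ h x ih =>
    choose k hk using ih
    obtain ⟨K, hK⟩ := (Set.finite_range k).bddAbove
    exact ⟨K + 1, .null x fun y => (hk y).mono (hK ⟨y, rfl⟩)⟩

theorem exists_depthLe_of_finite {X : Set (GTerm S C V)} (hX : X.Finite) :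
    ∃ k, ∀ t ∈ X, DepthLe k t := by
  choose k hk using exists_depthLe (S := S) (C := C) (V := V)
  obtain ⟨K, hK⟩ := (hX.image k).bddAbove
  exact ⟨K, fun t ht => (hk t).mono (hK ⟨t, ht, rfl⟩)⟩

theorem DepthLe.pos_of_child {k : ℕ} {t u : GTerm S C V} (h : DepthLe k t)
    (hc : GTerm.Child u t) : ∃ l, k = l + 1 ∧ DepthLe l u := by
  cases hc
  cases h with
  | null x hh => exact ⟨_, rfl, hh _⟩

end Depth

section Realization

variable {S : Signature} {C V : Type*} {D : Set (Atom S C)} {Γ : Set (TGD S V)}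

theorem DepEdge.predStep {S : Signature} {Γ : Set (TGD S V)} {s : Bool} {p q : S.Pred × ℕ}
    (h : DepEdge Γ s p q) : PredStep Γ p.1 q.1 := by
  obtain ⟨σ, hσ, x, hx, ⟨a, ha, hap, -⟩, hh⟩ := h
  cases s with
  | false =>
    obtain ⟨b, hb, hbq, -⟩ := hh
    exact ⟨σ, hσ, ⟨a, ha, hap⟩, b, hb, hbq⟩
  | true =>
    obtain ⟨z, -, b, hb, hbq, -⟩ := hh
    exact ⟨σ, hσ, ⟨a, ha, hap⟩, b, hb, hbq⟩

/-- Every predicate that is reachable from the database is the simplified type of an atom of the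
chase. -/
theorem exists_simpleType_of_reaches (hΓ : ∀ σ ∈ Γ, σ.IsGuarded)
    {a : Atom (simpleSig (linSig S)) C} (ha : a ∈ simpleDB (linDB D Γ))
    {p : (simpleSig (linSig S)).Pred} (hp : Reaches (simpleTGDs (linTGDs Γ)) a.pred p) :
    ∃ α ∈ chase D Γ, simpleType D Γ α = p := by
  induction hp with
  | refl =>
    obtain ⟨b, ⟨α, hα, τ, hτ, hpred, hpat, hinst, hbp, hba⟩, rfl⟩ := ha
    have hmem : α.map GTerm.const ∈ chase D Γ := InChase.base α hα
    have hid : identTuple (α.map (GTerm.const (S := S) (V := V))).args = identTuple α.args :=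
      identTuple_map fun _ _ _ _ e => GTerm.const.inj e
    refine ⟨_, hmem, SimplePred.ext' ?_ ?_⟩
    · have : τ = canType (chase D Γ) (sch Γ) (α.map GTerm.const) :=
        eq_canType_of_inst_eq (by
          have := hτ.1
          rw [hpred] at this
          exact this) hmem hτ hpred (hpat.identTuple_eq.trans hid.symm) hinst
      exact (hbp.trans this).symm
    · change identTuple _ = identTuple b.args
      rw [hba]
      exact hid
  | tail _ hstep ih =>
    obtain ⟨α, hα, rfl⟩ := ih
    obtain ⟨σ', hσ', ⟨b, hb, hbp⟩, c', hc', rfl⟩ := hstep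
    obtain ⟨σ, g, h, f, T, -, -, c, hc, hca⟩ := exists_isGuardTrigger hΓ hσ' hb hα hbp
    rw [hc] at hc'
    obtain ⟨a, ha, rfl⟩ := List.mem_map.1 hc'
    exact ⟨_, T.head_mem_chase ha, (hca a ha).1.symm⟩

theorem exists_atNode_of_depEdge (hΓ : ∀ σ ∈ Γ, σ.IsGuarded) {s : Bool}
    {p q : (simpleSig (linSig S)).Pred × ℕ} (he : DepEdge (simpleTGDs (linTGDs Γ)) s p q)
    {α : Atom S (GTerm S C V)} (hα : α ∈ chase D Γ) (hp : p.1 = simpleType D Γ α) :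
    ∃ t, AtNode D Γ α t p := by
  obtain ⟨σ', hσ', x, -, ⟨b, hb, hbp, hbx⟩, -⟩ := he
  obtain ⟨σ, g, h, f, T, rfl, ⟨b', hb', -, hba⟩, -⟩ :=
    exists_isGuardTrigger hΓ hσ' hb hα (hbp.trans hp)
  rw [hb'] at hb
  obtain rfl := List.mem_singleton.1 hb
  refine ⟨h x, hp, ?_⟩
  rw [T.unique_guard, List.getElem?_map, ← hba, hbx]
  rfl

/-- An edge of the dependency graph that starts at an occurrence of a term in the chase leads to an
occurrence of the same term, or, if it is special, of a null built from that term. -/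
theorem exists_atNode_succ (hΓ : ∀ σ ∈ Γ, σ.IsGuarded) {s : Bool}
    {p q : (simpleSig (linSig S)).Pred × ℕ} (he : DepEdge (simpleTGDs (linTGDs Γ)) s p q)
    {α : Atom S (GTerm S C V)} {t : GTerm S C V} (hα : α ∈ chase D Γ) (hp : AtNode D Γ α t p) :
    ∃ β ∈ chase D Γ, ∃ u, AtNode D Γ β u q ∧
      if s = true then GTerm.Child t u else u = t := by
  obtain ⟨σ', hσ', x, hx, ⟨b, hb, hbp, hbx⟩, hq⟩ := he
  obtain ⟨σ, g, h, f, T, rfl, hs⟩ := exists_isGuardTrigger hΓ hσ' hb hα (hbp.trans hp.1)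
  obtain ⟨⟨b', hb', -, hba⟩, c, hc, hca⟩ := id hs
  rw [hb'] at hb
  obtain rfl := List.mem_singleton.1 hb
  have hhx : h x = t := by
    have h2 := hp.2
    rw [T.unique_guard, List.getElem?_map, ← hba, hbx] at h2
    exact Option.some.inj h2
  have hxg : x ∈ g.args.map f := hs.mem_bodyVars.1 hx.1
  have hxg' : x ∈ g.args := by
    obtain ⟨u, hu, rfl⟩ := List.mem_map.1 hxg
    exact (T.spec.mem_and_idem hu).1
  have hhead : ∀ z, OccursAt σ'.head z q → ∃ a ∈ σ.head, z ∈ a.args.map f ∧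
      AtNode D Γ (a.map (headSubst σ h)) (simpleSubst σ g h z) q := by
    rintro z ⟨c', hc', hcq, hcz⟩
    rw [hc] at hc'
    obtain ⟨a, ha, rfl⟩ := List.mem_map.1 hc'
    rw [(hca a ha).2] at hcz
    refine ⟨a, ha, mem_unique.1 (List.mem_of_getElem? hcz), hcq.symm.trans (hca a ha).1, ?_⟩
    rw [T.unique_head ha, List.getElem?_map, hcz]
    rfl
  cases s with
  | false =>
    obtain ⟨a, ha, -, hat⟩ := hhead x hq
    rw [simpleSubst, if_pos hxg', hhx] at hat
    exact ⟨_, T.head_mem_chase ha, t, hat, rfl⟩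
  | true =>
    obtain ⟨z, hz, hzq⟩ := hq
    obtain ⟨a, ha, -, hat⟩ := hhead z hzq
    have hzg : z ∉ g.args := by
      intro hzg
      obtain ⟨a', ha', hz'⟩ := hs.mem_headVars.1 hz.1
      obtain ⟨w, hw, rfl⟩ := List.mem_map.1 hz'
      refine hz.2 (hs.mem_bodyVars.2 ?_)
      by_cases hwg : w ∈ g.args
      · exact List.mem_map_of_mem hwg
      · rw [T.spec.2 w hwg] at hzg
        exact absurd hzg hwg
    rw [simpleSubst, if_neg hzg] at hat
    refine ⟨_, T.head_mem_chase ha, _, hat, ?_⟩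
    -- a frontier variable of `σ` that is specialized to `x`
    obtain ⟨a', ha', hx'⟩ := hs.mem_headVars.1 hx.2
    obtain ⟨w, hw, rfl⟩ := List.mem_map.1 hx'
    have hwg : w ∈ g.args := by
      by_contra hwg
      rw [T.spec.2 w hwg] at hxg'
      exact hwg hxg'
    have hwf : w ∈ σ.frontier := T.mem_frontier ha' hw hwg
    rw [if_pos rfl, ← hhx, T.apply_spec hwg]
    exact .intro σ (fun y => h y.1) z ⟨w, hwf⟩

theorem isWeaklyAcyclic_of_finite_chase (hΓ : ∀ σ ∈ Γ, σ.IsGuarded) (hfin : (chase D Γ).Finite) :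
    IsWeaklyAcyclic (simpleDB (linDB D Γ)) (simpleTGDs (linTGDs Γ)) := by
  rintro ⟨n, v, s, hcyc, hedge, ⟨i₁, hi₁, hsp⟩, i₀, hi₀, a, ha, hreach⟩
  -- the cycle can be entered at its first node
  have hreach0 : Reaches (simpleTGDs (linTGDs Γ)) a.pred (v 0).1 := by
    have : ∀ j, i₀ + j ≤ n → Reaches (simpleTGDs (linTGDs Γ)) a.pred (v (i₀ + j)).1 := by
      intro j
      induction j with
      | zero => exact fun _ => hreach
      | succ j ih => exact fun hj => (ih (by omega)).tail (hedge (i₀ + j) (by omega)).predStep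
    have := this (n - i₀) (by omega)
    rwa [Nat.add_sub_cancel' hi₀, hcyc] at this
  obtain ⟨α₀, hα₀, hp₀⟩ := exists_simpleType_of_reaches hΓ ha hreach0
  obtain ⟨t₀, ht₀⟩ := exists_atNode_of_depEdge hΓ (hedge 0 (by omega)) hα₀ hp₀.symm
  -- each round along the cycle increases the depth
  have hround : ∀ k, ∃ α ∈ chase D Γ, ∃ t, AtNode D Γ α t (v 0) ∧ ∀ j, DepthLe j t → k ≤ j := by
    intro k
    induction k with
    | zero => exact ⟨α₀, hα₀, t₀, ht₀, fun _ _ => Nat.zero_le _⟩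
    | succ k ih =>
      obtain ⟨α, hα, t, ht, hk⟩ := ih
      have hwalk : ∀ i ≤ n, ∃ β ∈ chase D Γ, ∃ u, AtNode D Γ β u (v i) ∧
          ∀ j, DepthLe j u → k ≤ j ∧ (i₁ < i → k + 1 ≤ j) := by
        intro i
        induction i with
        | zero => exact fun _ => ⟨α, hα, t, ht, fun j hj => ⟨hk j hj, fun h => by omega⟩⟩
        | succ i ih =>
          intro hi
          obtain ⟨β, hβ, u, hu, hj⟩ := ih (by omega)
          obtain ⟨γ, hγ, w, hw, hstep⟩ := exists_atNode_succ hΓ (hedge i (by omega)) hβ hu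
          refine ⟨γ, hγ, w, hw, fun j hjw => ?_⟩
          by_cases hs : s i = true
          · rw [if_pos hs] at hstep
            obtain ⟨l, rfl, hl⟩ := hjw.pos_of_child hstep
            have := (hj l hl).1
            exact ⟨by omega, fun _ => by omega⟩
          · rw [if_neg hs] at hstep
            subst hstep
            refine ⟨(hj j hjw).1, fun hlt => (hj j hjw).2 ?_⟩
            have : i ≠ i₁ := by rintro rfl; exact hs hsp
            omega
      obtain ⟨β, hβ, u, hu, hj⟩ := hwalk n le_rfl
      rw [hcyc] at hu
      exact ⟨β, hβ, u, hu, fun j hju => (hj j hju).2 hi₁⟩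
  obtain ⟨K, hK⟩ := exists_depthLe_of_finite (finite_dom hfin)
  obtain ⟨α, hα, t, ht, hk⟩ := hround (K + 1)
  have := hk K (hK t ⟨α, hα, mem_unique.1 (List.mem_of_getElem? ht.2)⟩)
  omega

end Realization

/-! ### Weak acyclicity bounds the depth of terms -/

section DepthBound

variable {S : Signature} {C V : Type*} {D : Set (Atom S C)} {Γ : Set (TGD S V)}

/-- There is a path in the dependency graph that contains a special edge. -/
def SpecialPath {S : Signature} (Γ : Set (TGD S V)) (p q : S.Pred × ℕ) : Prop :=
  ∃ u w, Relation.ReflTransGen (fun p q => ∃ s, DepEdge Γ s p q) p u ∧ DepEdge Γ true u w ∧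
    Relation.ReflTransGen (fun p q => ∃ s, DepEdge Γ s p q) w q

theorem SpecialPath.trans {S : Signature} {Γ : Set (TGD S V)} {p q r : S.Pred × ℕ}
    (h : SpecialPath Γ p q) (h' : SpecialPath Γ q r) : SpecialPath Γ p r := by
  obtain ⟨u, w, hpu, huw, hwq⟩ := h
  obtain ⟨u', w', hqu, huw', hwr⟩ := h'
  exact ⟨u, w, hpu, huw, hwq.trans (hqu.trans (.head ⟨true, huw'⟩ hwr))⟩

/-- There is a walk from `p` to `q`, given by its sequences of nodes and edge kinds, which contains
a special edge if `b = true`. -/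
def Walk {S : Signature} (Γ : Set (TGD S V)) (b : Bool) (p q : S.Pred × ℕ) : Prop :=
  ∃ (n : ℕ) (v : ℕ → S.Pred × ℕ) (s : ℕ → Bool), v 0 = p ∧ v n = q ∧
    (∀ i < n, DepEdge Γ (s i) (v i) (v (i + 1))) ∧ (b = true → ∃ i < n, s i = true)

theorem Walk.snoc {S : Signature} {Γ : Set (TGD S V)} {b s : Bool} {p q r : S.Pred × ℕ}
    (h : Walk Γ b p q) (he : DepEdge Γ s q r) : Walk Γ (b || s) p r := by
  obtain ⟨n, v, k, rfl, rfl, hedge, hb⟩ := h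
  refine ⟨n + 1, fun i => if i ≤ n then v i else r, fun i => if i < n then k i else s, by simp,
    by simp, fun i hi => ?_, fun hbs => ?_⟩
  · rcases Nat.lt_succ_iff_lt_or_eq.1 hi with hlt | rfl
    · simpa [hlt, hlt.le, Nat.succ_le_of_lt hlt] using hedge i hlt
    · simpa using he
  · rcases Bool.or_eq_true_iff.1 hbs with hb' | hs
    · obtain ⟨i, hi, hk⟩ := hb hb'
      exact ⟨i, by omega, by simp [hi, hk]⟩
    · exact ⟨n, by omega, by simp [hs]⟩

theorem Walk.extend {S : Signature} {Γ : Set (TGD S V)} {b : Bool} {p q r : S.Pred × ℕ}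
    (h : Walk Γ b p q)
    (hr : Relation.ReflTransGen (fun p q => ∃ s, DepEdge Γ s p q) q r) : Walk Γ b p r := by
  induction hr with
  | refl => exact h
  | tail _ he ih =>
    obtain ⟨s, he⟩ := he
    obtain ⟨n, v, k, h1, h2, h3, h4⟩ := ih.snoc he
    exact ⟨n, v, k, h1, h2, h3, fun hb => h4 (by simp [hb])⟩

theorem SpecialPath.walk {S : Signature} {Γ : Set (TGD S V)} {p q : S.Pred × ℕ}
    (h : SpecialPath Γ p q) : Walk Γ true p q := by
  obtain ⟨u, w, hpu, huw, hwq⟩ := h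
  have h0 : Walk Γ false p p := ⟨0, fun _ => p, fun _ => false, rfl, rfl, by simp, by simp⟩
  exact ((h0.extend hpu).snoc huw).extend hwq

theorem IsWeaklyAcyclic.not_specialPath {S : Signature} {D : Set (Atom S C)} {Γ : Set (TGD S V)}
    (hwa : IsWeaklyAcyclic D Γ) {a : Atom S C} (ha : a ∈ D) {p : S.Pred × ℕ}
    (hp : Reaches Γ a.pred p.1) : ¬ SpecialPath Γ p p := by
  intro h
  obtain ⟨n, v, s, h0, hn, hedge, hs⟩ := h.walk
  exact hwa ⟨n, v, s, hn.trans h0.symm, hedge, hs rfl, 0, Nat.zero_le _, a, ha, by rwa [h0]⟩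

/-- The simplified type of every atom of the chase is reachable from the database. -/
theorem exists_reaches_simpleType (hΓ : ∀ σ ∈ Γ, σ.IsGuarded) {α : Atom S (GTerm S C V)}
    (hα : α ∈ chase D Γ) (hP : α.pred ∈ sch Γ) :
    ∃ a ∈ simpleDB (linDB D Γ), Reaches (simpleTGDs (linTGDs Γ)) a.pred (simpleType D Γ α) := by
  induction hα with
  | base a ha =>
    have hmem : a.map GTerm.const ∈ chase D Γ := InChase.base a ha
    have hid : identTuple (a.map (GTerm.const (S := S) (V := V))).args = identTuple a.args :=
      identTuple_map fun _ _ _ _ e => GTerm.const.inj e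
    let τ := canType (chase D Γ) (sch Γ) (a.map GTerm.const)
    let b : Atom (linSig S) C := { pred := τ, args := a.args, length_args := a.length_args }
    have hpat : SamePattern τ.guard.args a.args := by
      have h1 : τ.guard.args = a.args.map (ident a.args) := hid
      rw [h1]
      exact samePattern_map (ident_injOn _)
    refine ⟨simpleAtom b, ⟨b, ⟨a, ha, τ, isType_canType Γ _ hP, rfl, hpat, ?_, rfl, rfl⟩, rfl⟩, ?_⟩
    · exact inst_canType hmem hP
    · have : (simpleAtom b).pred = simpleType D Γ (a.map GTerm.const) :=
        SimplePred.ext' rfl hid.symm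
      rw [this]
      exact .refl
  | step σ hσ h hb β hβ ih =>
    obtain ⟨a, ha, rfl⟩ := hβ
    obtain ⟨g, f, T, σ', hσ', hs⟩ := exists_simulates hΓ hσ hb
    obtain ⟨b, hb, hr⟩ := ih g T.guard_mem T.pred_guard_mem
    exact ⟨b, hb, hr.tail (hs.predStep hσ' ha)⟩

/-- If the null `t` occurs in the chase, then each term in its name occurs in an atom of the chase
from where a path with a special edge leads to the occurrence of `t`. -/
theorem exists_specialPath (hΓ : ∀ σ ∈ Γ, σ.IsGuarded) {γ : Atom S (GTerm S C V)}
    (hγ : γ ∈ chase D Γ) {t u : GTerm S C V} (ht : t ∈ γ.args) (hu : GTerm.Child u t)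
    {q : (simpleSig (linSig S)).Pred × ℕ} (hq : AtNode D Γ γ t q) :
    ∃ α ∈ chase D Γ, α.pred ∈ sch Γ ∧ ∃ p, AtNode D Γ α u p ∧
      SpecialPath (simpleTGDs (linTGDs Γ)) p q := by
  induction hγ generalizing q with
  | base a ha =>
    obtain ⟨c, -, rfl⟩ := Atom.mem_args_map.1 ht
    cases hu
  | step σ hσ h hb β hβ ih =>
    obtain ⟨a, ha, rfl⟩ := hβ
    obtain ⟨v, hv, rfl⟩ := Atom.mem_args_map.1 ht
    obtain ⟨g, f, T, σ', hσ', hs⟩ := exists_simulates hΓ hσ hb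
    by_cases hvf : v ∈ σ.frontier
    · rw [headSubst_of_mem hvf] at hu hq
      have hvα : h v ∈ (g.map h).args := List.mem_map_of_mem (T.frontier_subset hvf)
      obtain ⟨r, hr⟩ := exists_atNode D Γ hvα
      have hedge := T.normal_edge hσ' hs ha hv hvf hr hq
      rw [headSubst_of_mem hvf] at ih
      obtain ⟨α, hα, hP, p, hp, x, y, hpx, hxy, hyr⟩ := ih g T.guard_mem hvα hr
      exact ⟨α, hα, hP, p, hp, x, y, hpx, hxy, hyr.tail ⟨false, hedge⟩⟩
    · have hu' := hu
      rw [headSubst_of_not_mem hvf] at hu'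
      cases hu' with
      | intro _ _ _ y =>
        have hyα : h y ∈ (g.map h).args := List.mem_map_of_mem (T.frontier_subset y.2)
        obtain ⟨p, hp⟩ := exists_atNode D Γ hyα
        exact ⟨_, T.guard_mem_chase, T.pred_guard_mem, p, hp, p, q, .refl,
          T.special_edge hσ' hs ha y.2 hv hvf hp hq, .refl⟩

/-- The nodes of the dependency graph at which a term of the chase occurs. -/
def realizedNodes (D : Set (Atom S C)) (Γ : Set (TGD S V)) :
    Set ((simpleSig (linSig S)).Pred × ℕ) :=
  {p | ∃ α ∈ chase D Γ, α.pred ∈ sch Γ ∧ ∃ t, AtNode D Γ α t p}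

/-- A term of depth more than `k` occurs at the end of a chain of `k + 1` nodes that are linked by
paths with special edges. -/
theorem exists_chain_of_not_depthLe (hΓ : ∀ σ ∈ Γ, σ.IsGuarded) (k : ℕ)
    {γ : Atom S (GTerm S C V)} (hγ : γ ∈ chase D Γ) (hP : γ.pred ∈ sch Γ) {t : GTerm S C V}
    (ht : ¬ DepthLe k t) {q : (simpleSig (linSig S)).Pred × ℕ} (hq : AtNode D Γ γ t q) :
    ∃ l : List ((simpleSig (linSig S)).Pred × ℕ), l.length = k ∧
      (∀ p ∈ l, p ∈ realizedNodes D Γ) ∧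
      List.Pairwise (fun p p' => SpecialPath (simpleTGDs (linTGDs Γ)) p' p) (q :: l) := by
  induction k generalizing γ t q with
  | zero => exact ⟨[], rfl, by simp, by simp⟩
  | succ k ih =>
    have hchild : ∃ u, GTerm.Child u t ∧ ¬ DepthLe k u := by
      cases t with
      | const c => exact absurd (.const _ c) ht
      | null σ h x =>
        by_contra hcon
        refine ht (.null x fun y => ?_)
        by_contra hy
        exact hcon ⟨_, .intro σ h x y, hy⟩
    obtain ⟨u, hu, hk⟩ := hchild
    obtain ⟨α, hα, hαP, p, hp, hpath⟩ :=
      exists_specialPath hΓ hγ (mem_unique.1 (List.mem_of_getElem? hq.2)) hu hq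
    obtain ⟨l, hl, hmem, hpw⟩ := ih hα hαP hk hp
    refine ⟨p :: l, by simp [hl], ?_, List.pairwise_cons.2 ⟨?_, hpw⟩⟩
    · rintro r (_ | ⟨_, hr⟩)
      · exact ⟨α, hα, hαP, u, hp⟩
      · exact hmem r hr
    · rintro r (_ | ⟨_, hr⟩)
      · exact hpath
      · exact ((List.pairwise_cons.1 hpw).1 r hr).trans hpath

theorem depthLe_of_isWeaklyAcyclic (hΓ : ∀ σ ∈ Γ, σ.IsGuarded)
    (hwa : IsWeaklyAcyclic (simpleDB (linDB D Γ)) (simpleTGDs (linTGDs Γ)))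
    (hfin : (realizedNodes D Γ).Finite) {d : ℕ} (hd : (realizedNodes D Γ).ncard ≤ d)
    {γ : Atom S (GTerm S C V)} (hγ : γ ∈ chase D Γ) (hP : γ.pred ∈ sch Γ) {t : GTerm S C V}
    (ht : t ∈ γ.args) : DepthLe d t := by
  classical
  by_contra hcon
  obtain ⟨q, hq⟩ := exists_atNode D Γ ht
  obtain ⟨l, hl, hmem, hpw⟩ := exists_chain_of_not_depthLe hΓ d hγ hP hcon hq
  have hmem' : ∀ p ∈ q :: l, p ∈ realizedNodes D Γ := by
    rintro p (_ | ⟨_, hp⟩)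
    · exact ⟨γ, hγ, hP, t, hq⟩
    · exact hmem p hp
  have hnodup : (q :: l).Nodup := by
    refine hpw.imp_of_mem fun {p p'} hp _ h => ?_
    rintro rfl
    obtain ⟨α, hα, hαP, u, hu⟩ := hmem' p hp
    obtain ⟨b, hb, hr⟩ := exists_reaches_simpleType hΓ hα hαP
    rw [← hu.1] at hr
    exact hwa.not_specialPath hb hr h
  have hle : ((q :: l).toFinset : Set _).ncard ≤ (realizedNodes D Γ).ncard :=
    Set.ncard_le_ncard (fun p hp => hmem' p (by simpa using hp)) hfin
  rw [Set.ncard_coe_finset, List.toFinset_card_of_nodup hnodup, List.length_cons, hl] at hle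
  omega

end DepthBound

/-! ### Counting types and atoms -/

section Counting

variable {S : Signature} {C V T : Type*}

theorem exists_finset_atoms (P : Finset S.Pred) (W : Finset T) {m w : ℕ}
    (hm : ∀ R ∈ P, S.arity R ≤ m) (hw : W.card ≤ w) (hw1 : 1 ≤ w) :
    ∃ F : Finset (Atom S T), F.card ≤ P.card * w ^ m ∧
      ∀ α : Atom S T, α.pred ∈ P → (∀ t ∈ α.args, t ∈ W) → α ∈ F := by
  classical
  let mk : ∀ R : S.Pred, (Fin (S.arity R) → T) → Atom S T := fun R φ =>
    { pred := R, args := List.ofFn φ, length_args := List.length_ofFn }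
  refine ⟨P.biUnion fun R => (Fintype.piFinset fun _ => W).image (mk R), ?_, ?_⟩
  · refine Finset.card_biUnion_le_card_mul _ _ _ fun R hR => Finset.card_image_le.trans ?_
    rw [Fintype.card_piFinset_const]
    exact (Nat.pow_le_pow_left hw _).trans (Nat.pow_le_pow_right hw1 (by simpa using hm R hR))
  · intro α hα hargs
    refine Finset.mem_biUnion.2 ⟨α.pred, hα, Finset.mem_image.2
      ⟨fun i => α.args[i.1]'(by rw [α.length_args]; exact i.2), ?_, ?_⟩⟩
    · exact Fintype.mem_piFinset.2 fun i => hargs _ (List.getElem_mem _)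
    · ext1
      · rfl
      · refine List.ext_getElem (by simp [mk, α.length_args]) fun i hi hi' => ?_
        simp [mk]

theorem finite_atomsOf {Γ : Set (TGD S V)} (hΓ : Γ.Finite) : (atomsOf Γ).Finite := by
  have : atomsOf Γ = ⋃ σ ∈ Γ, ({a | a ∈ σ.body} ∪ {a | a ∈ σ.head}) := by
    ext a; simp [atomsOf]
  rw [this]
  exact hΓ.biUnion fun σ _ => (List.finite_toSet _).union (List.finite_toSet _)

theorem finite_sch {Γ : Set (TGD S V)} (hΓ : Γ.Finite) : (sch Γ).Finite :=
  (finite_atomsOf hΓ).image _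

theorem arity_le_ar {Γ : Set (TGD S V)} (hΓ : Γ.Finite) {R : S.Pred} (hR : R ∈ sch Γ) :
    S.arity R ≤ ar Γ :=
  le_csSup ((finite_sch hΓ).image _).bddAbove ⟨R, hR, rfl⟩

theorem ar_pos {Γ : Set (TGD S V)} (hΓ : Γ.Finite) (hne : Γ.Nonempty) : 1 ≤ ar Γ := by
  obtain ⟨σ, hσ⟩ := hne
  have h := pred_mem_sch_of_body hσ (List.head_mem σ.body_ne)
  exact (S.arity_pos _).trans_le (arity_le_ar hΓ h)

theorem ncard_args_le (a : Atom S T) : {t | t ∈ a.args}.ncard ≤ S.arity a.pred := by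
  classical
  have : {t | t ∈ a.args} = (a.args.toFinset : Set T) := by ext; simp
  rw [this, Set.ncard_coe_finset]
  exact (List.toFinset_card_le _).trans a.length_args.le

theorem ncard_headVars_le {Γ : Set (TGD S V)} (hΓ : Γ.Finite) {σ : TGD S V} (hσ : σ ∈ Γ) :
    σ.headVars.ncard ≤ (atomsOf Γ).ncard * ar Γ := by
  classical
  have h1 : σ.headVars = (σ.head.toFinset.biUnion fun a => a.args.toFinset : Finset V) := by
    ext v; simp [TGD.headVars, dom]
  rw [h1, Set.ncard_coe_finset]
  refine (Finset.card_biUnion_le_card_mul _ _ (ar Γ) fun a ha => ?_).trans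
    (Nat.mul_le_mul_right _ ?_)
  · refine (List.toFinset_card_le _).trans (a.length_args.le.trans (arity_le_ar hΓ ?_))
    exact pred_mem_sch_of_head hσ (by simpa using ha)
  · rw [← Set.ncard_coe_finset]
    exact Set.ncard_le_ncard (fun a ha => ⟨σ, hσ, Or.inr (by simpa using ha)⟩) (finite_atomsOf hΓ)

/-- TGDs without common variables have no common atoms. -/
theorem card_le_ncard_atomsOf (Γ : Finset (TGD S V))
    (hvars : ∀ σ ∈ Γ, ∀ σ' ∈ Γ, σ ≠ σ' → Disjoint σ.vars σ'.vars) :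
    Γ.card ≤ (atomsOf (Γ : Set (TGD S V))).ncard := by
  rw [← Set.ncard_coe_finset]
  have hmem : ∀ σ : TGD S V, σ.body.head σ.body_ne ∈ σ.body := fun σ => List.head_mem _
  refine Set.ncard_le_ncard_of_injOn (fun σ => σ.body.head σ.body_ne)
    (fun σ hσ => ⟨σ, hσ, Or.inl (hmem σ)⟩) ?_ (finite_atomsOf Γ.finite_toSet)
  intro σ hσ σ' hσ' e
  by_contra hne
  obtain ⟨v, hv⟩ := (σ.body.head σ.body_ne).exists_mem_args
  have h1 : v ∈ σ.vars := Or.inl ⟨_, hmem σ, hv⟩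
  have h2 : v ∈ σ'.vars := Or.inl ⟨_, hmem σ', by
    have e' : σ.body.head σ.body_ne = σ'.body.head σ'.body_ne := e
    rw [← e']; exact hv⟩
  exact Set.disjoint_left.1 (hvars σ hσ σ' hσ' hne) h1 h2

theorem ncard_frontier_le {Γ : Set (TGD S V)} (hΓ : Γ.Finite) {σ : TGD S V} (hσ : σ ∈ Γ)
    (hg : σ.IsGuarded) : Nat.card {x // x ∈ σ.frontier} ≤ ar Γ := by
  obtain ⟨g, hgb, hgg⟩ := hg
  refine (Set.ncard_le_ncard (s := σ.frontier) (t := {t | t ∈ g.args}) (fun v hv => hgg v hv.1)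
    (List.finite_toSet _)).trans ((ncard_args_le g).trans ?_)
  exact arity_le_ar hΓ (pred_mem_sch_of_body hσ hgb)

theorem ncard_realizedNodes_le {D : Set (Atom S C)} {Γ : Set (TGD S V)} (hΓ : Γ.Finite)
    (hne : Γ.Nonempty) : (realizedNodes D Γ).Finite ∧
      (realizedNodes D Γ).ncard ≤ depthBound (sch Γ).ncard (ar Γ) := by
  classical
  set n := (sch Γ).ncard with hn
  set m := ar Γ with hm
  have hm1 : 1 ≤ m := ar_pos hΓ hne
  obtain ⟨A, hA, hAmem⟩ := exists_finset_atoms (T := ℕ) (finite_sch hΓ).toFinset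
    (Finset.Icc 1 m) (m := m) (w := m) (fun R hR => arity_le_ar hΓ (by simpa using hR))
    (by simp) hm1
  rw [← Set.ncard_eq_toFinset_card _ (finite_sch hΓ), ← hn] at hA
  -- the tuple of identifiers is that of the guard, so a type and an index determine the node
  let mk : (Atom S ℕ × Finset (Atom S ℕ)) × ℕ → (simpleSig (linSig S)).Pred × ℕ := fun x =>
    ({ base := IntType.mk x.1.1 x.1.2, ids := x.1.1.args, length_ids := x.1.1.length_args }, x.2)
  have hsub : realizedNodes D Γ ⊆
      (((A ×ˢ A.powerset) ×ˢ Finset.range m).image mk : Finset _) := by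
    rintro ⟨p, i⟩ ⟨α, hα, hP, t, hp, hi⟩
    have hle : ∀ s ∈ α.args, 1 ≤ ident α.args s ∧ ident α.args s ≤ m := fun s hs =>
      ⟨one_le_ident _ _, (ident_le_length hs).trans (α.length_args.le.trans (arity_le_ar hΓ hP))⟩
    have hA' : ∀ β : Atom S (GTerm S C V), β.pred ∈ sch Γ → (∀ s ∈ β.args, s ∈ α.args) →
        β.map (ident α.args) ∈ A := by
      intro β hβ hβα
      refine hAmem _ ((finite_sch hΓ).mem_toFinset.2 hβ) fun k hk => ?_
      obtain ⟨s, hs, rfl⟩ := Atom.mem_args_map.1 hk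
      exact Finset.mem_Icc.2 (hle s (hβα s hs))
    have hside : (canType (chase D Γ) (sch Γ) α).side ⊆ (A : Set (Atom S ℕ)) := by
      rintro _ ⟨β, ⟨⟨-, hβ, hβα⟩, -⟩, rfl⟩
      exact hA' β hβ hβα
    have hfin := A.finite_toSet.subset hside
    rw [Finset.mem_coe, Finset.mem_image]
    refine ⟨((α.map (ident α.args), hfin.toFinset), i), ?_, ?_⟩
    · simp only [Finset.mem_product, Finset.mem_powerset, Finset.mem_range]
      refine ⟨⟨hA' α hP fun _ h => h, fun β hβ => hside (by simpa using hβ)⟩, ?_⟩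
      obtain ⟨hi', -⟩ := List.getElem?_eq_some_iff.1 hi
      exact hi'.trans_le ((length_unique_le _).trans (α.length_args.le.trans (arity_le_ar hΓ hP)))
    · obtain rfl : p = _ := hp
      refine Prod.ext (SimplePred.ext' ?_ rfl) rfl
      simp only [mk, Set.Finite.coe_toFinset]
      rfl
  refine ⟨(Finset.finite_toSet _).subset hsub, ?_⟩
  refine (Set.ncard_le_ncard hsub (Finset.finite_toSet _)).trans ?_
  rw [Set.ncard_coe_finset]
  refine Finset.card_image_le.trans ?_
  rw [Finset.card_product, Finset.card_product, Finset.card_powerset, Finset.card_range]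
  calc A.card * 2 ^ A.card * m ≤ (n * m ^ m) * 2 ^ (n * m ^ m) * m := by gcongr; norm_num
    _ = n * m ^ (m + 1) * 2 ^ (n * m ^ m) := by ring
    _ ≤ n * m ^ (2 * m + 1) * 2 ^ (n * m ^ m) := by
      gcongr
      omega

/-- The bags of the chase, by level: the terms of an atom of the database at level `0`, and the
terms of the result of a trigger whose frontier values belong to a bag of the previous level. -/
inductive IsBag (D : Set (Atom S C)) (Γ : Set (TGD S V)) : ℕ → Set (GTerm S C V) → Prop
  | base (a : Atom S C) (ha : a ∈ D) (hP : a.pred ∈ sch Γ) :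
      IsBag D Γ 0 {t | t ∈ (a.map (GTerm.const (S := S) (V := V))).args}
  | step {i : ℕ} {B : Set (GTerm S C V)} (hB : IsBag D Γ i B) (σ : TGD S V) (hσ : σ ∈ Γ)
      (φ : {x // x ∈ σ.frontier} → GTerm S C V) (hφ : ∀ y, φ y ∈ B) :
      IsBag D Γ (i + 1) (frontierSubst σ φ '' σ.headVars)

/-- The terms of depth at most `k` of an atom of the chase lie in one bag of level at most `k`. A
null of depth `k + 1` puts the whole result of its trigger in the bag generated by the one that
covers the frontier values, which have depth at most `k`. -/
theorem exists_isBag {D : Set (Atom S C)} {Γ : Set (TGD S V)} (hΓ : ∀ σ ∈ Γ, σ.IsGuarded)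
    {γ : Atom S (GTerm S C V)} (hγ : γ ∈ chase D Γ) (hP : γ.pred ∈ sch Γ) (k : ℕ) :
    ∃ i ≤ k, ∃ B, IsBag D Γ i B ∧ ∀ t ∈ γ.args, DepthLe k t → t ∈ B := by
  induction hγ generalizing k with
  | base a ha => exact ⟨0, Nat.zero_le _, _, .base a ha hP, fun t ht _ => ht⟩
  | step σ hσ h hb β hβ ih =>
    obtain ⟨a, ha, rfl⟩ := hβ
    obtain ⟨g, hg, hgg⟩ := hΓ σ hσ
    have ih := ih g hg (pred_mem_sch_of_body hσ hg)
    by_cases hnew : ∃ v ∈ a.args, v ∉ σ.frontier ∧ DepthLe k (headSubst σ h v)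
    · obtain ⟨v, hv, hvf, hd⟩ := hnew
      rw [headSubst_of_not_mem hvf] at hd
      generalize hn : GTerm.null σ (fun y => h y.1) v = u at hd
      cases hd with
      | const => cases hn
      | @null k σ' h' x hh =>
        obtain ⟨rfl, hφ, -⟩ := GTerm.null.inj hn
        obtain rfl := eq_of_heq hφ
        obtain ⟨i, hi, B, hB, hcov⟩ := ih k
        refine ⟨i + 1, by omega, _, .step hB σ hσ (fun y => h y.1) fun y =>
          hcov _ (List.mem_map_of_mem (hgg y y.2.1)) (hh y), fun t ht _ => ?_⟩
        obtain ⟨w, hw, rfl⟩ := Atom.mem_args_map.1 ht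
        exact ⟨w, ⟨a, ha, hw⟩, by rw [headSubst_eq_frontierSubst]⟩
    · obtain ⟨i, hi, B, hB, hcov⟩ := ih k
      refine ⟨i, hi, B, hB, fun t ht hd => ?_⟩
      obtain ⟨v, hv, rfl⟩ := Atom.mem_args_map.1 ht
      by_cases hvf : v ∈ σ.frontier
      · rw [headSubst_of_mem hvf] at hd ⊢
        exact hcov _ (List.mem_map_of_mem (hgg v hvf.1)) hd
      · exact absurd ⟨v, hv, hvf, hd⟩ hnew

theorem IsBag.ncard_le {D : Set (Atom S C)} {Γ : Set (TGD S V)} (hΓ : Γ.Finite) {i : ℕ}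
    {B : Set (GTerm S C V)} (hB : IsBag D Γ i B) :
    B.Finite ∧ B.ncard ≤ (atomsOf Γ).ncard * ar Γ := by
  cases hB with
  | base a ha hP =>
    refine ⟨List.finite_toSet _, (ncard_args_le _).trans ((arity_le_ar hΓ hP).trans ?_)⟩
    refine Nat.le_mul_of_pos_left _ ((Set.ncard_pos (finite_atomsOf hΓ)).2 ?_)
    obtain ⟨b, hb, -⟩ := hP
    exact ⟨b, hb⟩
  | step hB σ hσ φ hφ =>
    have hfin : σ.headVars.Finite := finite_dom_list _
    exact ⟨hfin.image _, (Set.ncard_image_le hfin).trans (ncard_headVars_le hΓ hσ)⟩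

theorem exists_finset_isBag {D : Set (Atom S C)} (D₀ : Finset (Atom S C)) (Γ : Finset (TGD S V))
    (hΓ : ∀ σ ∈ Γ, σ.IsGuarded) (hD₀ : ∀ a ∈ D, a.pred ∈ sch (Γ : Set (TGD S V)) → a ∈ D₀)
    {w m : ℕ} (hw1 : 1 ≤ w)
    (hw : w = (atomsOf (Γ : Set (TGD S V))).ncard * ar (Γ : Set (TGD S V)))
    (hm : m = ar (Γ : Set (TGD S V))) (i : ℕ) :
    ∃ F : Finset (Set (GTerm S C V)), F.card ≤ D₀.card * (Γ.card * w ^ m) ^ i ∧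
      ∀ B, IsBag D (Γ : Set (TGD S V)) i B → B ∈ F := by
  classical
  induction i with
  | zero =>
    refine ⟨D₀.image fun a => {t | t ∈ (a.map (GTerm.const (S := S) (V := V))).args},
      Finset.card_image_le.trans (by simp), ?_⟩
    intro B hB
    cases hB with
    | base a ha hP => exact Finset.mem_image_of_mem _ (hD₀ a ha hP)
  | succ i ih =>
    obtain ⟨F, hF, hmem⟩ := ih
    -- the bag as a finset; the value `∅` is never used, as bags are finite
    let fill : Set (GTerm S C V) → Finset (GTerm S C V) := fun B =>
      if hB : B.Finite then hB.toFinset else ∅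
    have hfill : ∀ B ∈ F.filter fun B => IsBag D (Γ : Set (TGD S V)) i B,
        (fill B : Set (GTerm S C V)) = B ∧ (fill B).card ≤ w := by
      intro B hB
      obtain ⟨hfin, hcard⟩ := (Finset.mem_filter.1 hB).2.ncard_le Γ.finite_toSet
      have h1 : fill B = hfin.toFinset := dif_pos hfin
      rw [h1, hfin.coe_toFinset, ← Set.ncard_eq_toFinset_card B hfin, hw]
      exact ⟨rfl, hcard⟩
    have _ (σ : TGD S V) : Fintype {x // x ∈ σ.frontier} := Fintype.ofFinite _
    refine ⟨(F.filter fun B => IsBag D (Γ : Set (TGD S V)) i B).biUnion fun B => Γ.biUnion fun σ =>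
      (Fintype.piFinset fun _ : {x // x ∈ σ.frontier} => fill B).image fun φ =>
        frontierSubst σ φ '' σ.headVars, ?_, ?_⟩
    · rw [pow_succ, ← mul_assoc]
      refine (Finset.card_biUnion_le_card_mul _ _ (Γ.card * w ^ m) fun B hB => ?_).trans
        (Nat.mul_le_mul_right _ ((Finset.card_filter_le _ _).trans hF))
      refine Finset.card_biUnion_le_card_mul _ _ _ fun σ hσ => Finset.card_image_le.trans ?_
      rw [Fintype.card_piFinset, Finset.prod_const, Finset.card_univ, ← Nat.card_eq_fintype_card]
      refine (Nat.pow_le_pow_left (hfill B hB).2 _).trans (Nat.pow_le_pow_right hw1 ?_)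
      rw [hm]
      exact ncard_frontier_le Γ.finite_toSet hσ (hΓ σ hσ)
    · intro B' hB'
      cases hB' with
      | @step _ B hB σ hσ φ hφ =>
        have hBF := Finset.mem_filter.2 ⟨hmem B hB, hB⟩
        refine Finset.mem_biUnion.2 ⟨B, hBF, Finset.mem_biUnion.2 ⟨σ, hσ, Finset.mem_image.2
          ⟨φ, Fintype.mem_piFinset.2 fun y => ?_, rfl⟩⟩⟩
        rw [← Finset.mem_coe, (hfill B hBF).1]
        exact hφ y

theorem chase_empty (D : Set (Atom S C)) : chase D (∅ : Set (TGD S V)) = toInstance V D := by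
  ext γ
  constructor
  · intro hγ
    cases hγ with
    | base a ha => exact ⟨a, ha, rfl⟩
    | step σ hσ => exact hσ.elim
  · rintro ⟨a, ha, rfl⟩
    exact InChase.base a ha

/-- If all terms over the schema have depth at most `d`, the chase consists of atoms over the bags
of level at most `d` and atoms of the database. -/
theorem encard_chase_le_of_depthLe (D : Finset (Atom S C)) (Γ : Finset (TGD S V))
    (hΓ : ∀ σ ∈ Γ, σ.IsGuarded)
    (hvars : ∀ σ ∈ Γ, ∀ σ' ∈ Γ, σ ≠ σ' → Disjoint σ.vars σ'.vars) (hne : Γ.Nonempty)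
    {a n m d : ℕ} (ha : a = (atomsOf (Γ : Set (TGD S V))).ncard)
    (hn : n = (sch (Γ : Set (TGD S V))).ncard) (hm : m = ar (Γ : Set (TGD S V)))
    (hd : ∀ γ ∈ chase (D : Set (Atom S C)) (Γ : Set (TGD S V)), γ.pred ∈ sch (Γ : Set (TGD S V)) →
      ∀ t ∈ γ.args, DepthLe d t) :
    (chase (D : Set (Atom S C)) (Γ : Set (TGD S V))).encard ≤
      ((D.card * ((d + 1) * (a * n * m) ^ (2 * m * (d + 1))) : ℕ) : ℕ∞) := by
  classical
  have hfin : (Γ : Set (TGD S V)).Finite := Γ.finite_toSet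
  have hm1 : 1 ≤ m := hm ▸ ar_pos hfin hne
  have hn1 : 1 ≤ n := by
    obtain ⟨σ, hσ⟩ := hne
    rw [hn]
    exact (Set.ncard_pos (finite_sch hfin)).2
      ⟨_, pred_mem_sch_of_body hσ (List.head_mem σ.body_ne)⟩
  have hΓa : Γ.card ≤ a := ha ▸ card_le_ncard_atomsOf Γ hvars
  have ha1 : 1 ≤ a := (Finset.card_pos.2 hne).trans_le hΓa
  have hw1 : 1 ≤ a * m := Nat.mul_pos ha1 hm1
  set b := a * n * m with hb
  have hb1 : 1 ≤ b := Nat.mul_pos (Nat.mul_pos ha1 hn1) hm1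
  have hab : a ≤ b := by rw [hb, mul_assoc]; exact Nat.le_mul_of_pos_right _ (Nat.mul_pos hn1 hm1)
  have hnb : n ≤ b := by
    rw [hb, mul_comm a n, mul_assoc]; exact Nat.le_mul_of_pos_right _ hw1
  have hwb : a * m ≤ b := Nat.mul_le_mul_right _ (Nat.le_mul_of_pos_right _ hn1)
  have hpow : ∀ x ≤ b, x * (a * m) ^ m ≤ b ^ (2 * m) := by
    intro x hx
    rw [two_mul, pow_add]
    refine Nat.mul_le_mul (hx.trans ?_) (Nat.pow_le_pow_left hwb _)
    exact Nat.le_self_pow (by omega) b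
  -- the atoms of the database outside the schema take part in no trigger and are counted apart
  let D₁ := D.filter fun α => α.pred ∈ sch (Γ : Set (TGD S V))
  let D₂ := D.filter fun α => ¬ α.pred ∈ sch (Γ : Set (TGD S V))
  have hcard : D₁.card + D₂.card = D.card := Finset.card_filter_add_card_filter_not _
  choose F hF hFmem using exists_finset_isBag (D := (D : Set (Atom S C))) D₁ Γ hΓ
    (fun α hα hP => Finset.mem_filter.2 ⟨hα, hP⟩) hw1 (by rw [ha, hm]) hm
  have hover : ∀ i B, IsBag (D : Set (Atom S C)) (Γ : Set (TGD S V)) i B →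
      ∃ G : Finset (Atom S (GTerm S C V)), G.card ≤ b ^ (2 * m) ∧
        ∀ α : Atom S (GTerm S C V), α.pred ∈ sch (Γ : Set (TGD S V)) →
          (∀ t ∈ α.args, t ∈ B) → α ∈ G := by
    intro i B hB
    obtain ⟨hBfin, hBcard⟩ := hB.ncard_le hfin
    rw [← ha, ← hm, Set.ncard_eq_toFinset_card B hBfin] at hBcard
    obtain ⟨G, hG, hGmem⟩ := exists_finset_atoms (finite_sch hfin).toFinset hBfin.toFinset
      (m := m) (fun R hR => hm ▸ arity_le_ar hfin ((finite_sch hfin).mem_toFinset.1 hR)) hBcard hw1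
    rw [← Set.ncard_eq_toFinset_card _ (finite_sch hfin), ← hn] at hG
    exact ⟨G, hG.trans (hpow n hnb), fun α hα hargs => hGmem α ((finite_sch hfin).mem_toFinset.2 hα)
      fun t ht => hBfin.mem_toFinset.2 (hargs t ht)⟩
  choose! G hG hGmem using hover
  let Y : Finset (Atom S (GTerm S C V)) := D₂.image (Atom.map GTerm.const) ∪
    (Finset.range (d + 1)).biUnion fun i =>
      ((F i).filter fun B => IsBag (D : Set (Atom S C)) (Γ : Set (TGD S V)) i B).biUnion (G i)
  have hY : chase (D : Set (Atom S C)) (Γ : Set (TGD S V)) ⊆ (Y : Set (Atom S (GTerm S C V))) := by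
    intro γ hγ
    by_cases hP : γ.pred ∈ sch (Γ : Set (TGD S V))
    · obtain ⟨i, hi, B, hB, hcov⟩ := exists_isBag hΓ hγ hP d
      refine Finset.mem_union_right _ (Finset.mem_biUnion.2 ⟨i, Finset.mem_range.2 (by omega),
        Finset.mem_biUnion.2 ⟨B, Finset.mem_filter.2 ⟨hFmem i B hB, hB⟩, ?_⟩⟩)
      exact hGmem i B hB γ hP fun t ht => hcov t ht (hd γ hγ hP t ht)
    · refine Finset.mem_union_left _ (Finset.mem_image.2 ?_)
      cases hγ with
      | base α hα => exact ⟨α, Finset.mem_filter.2 ⟨hα, hP⟩, rfl⟩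
      | step σ hσ h hb β hβ =>
        obtain ⟨c, hc, rfl⟩ := hβ
        exact absurd (pred_mem_sch_of_head hσ hc) hP
  have hYcard : Y.card ≤ D.card * ((d + 1) * b ^ (2 * m * (d + 1))) := by
    have hlevel : ∀ i ∈ Finset.range (d + 1),
        (((F i).filter fun B => IsBag (D : Set (Atom S C)) (Γ : Set (TGD S V)) i B).biUnion
          (G i)).card ≤ D₁.card * b ^ (2 * m * (d + 1)) := by
      intro i hi
      refine (Finset.card_biUnion_le_card_mul _ _ _ fun B hB =>
        hG i B (Finset.mem_filter.1 hB).2).trans ?_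
      refine (Nat.mul_le_mul_right _ ((Finset.card_filter_le _ _).trans (hF i))).trans ?_
      rw [mul_assoc]
      refine Nat.mul_le_mul_left _ ?_
      calc (Γ.card * (a * m) ^ m) ^ i * b ^ (2 * m) ≤ (b ^ (2 * m)) ^ i * b ^ (2 * m) :=
            Nat.mul_le_mul_right _ (Nat.pow_le_pow_left (hpow _ (hΓa.trans hab)) _)
        _ = b ^ (2 * m * (i + 1)) := by rw [← pow_succ, ← pow_mul]
        _ ≤ b ^ (2 * m * (d + 1)) := by
          refine Nat.pow_le_pow_right hb1 (Nat.mul_le_mul_left _ ?_)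
          exact Finset.mem_range.1 hi
    have hpos : 1 ≤ (d + 1) * b ^ (2 * m * (d + 1)) :=
      Nat.mul_pos (Nat.succ_pos d) (Nat.pow_pos hb1)
    calc Y.card ≤ D₂.card + (d + 1) * (D₁.card * b ^ (2 * m * (d + 1))) := by
          refine (Finset.card_union_le _ _).trans (Nat.add_le_add Finset.card_image_le ?_)
          refine (Finset.card_biUnion_le_card_mul _ _ _ hlevel).trans ?_
          rw [Finset.card_range]
      _ ≤ D₂.card * ((d + 1) * b ^ (2 * m * (d + 1))) +
          D₁.card * ((d + 1) * b ^ (2 * m * (d + 1))) := by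
          refine Nat.add_le_add (Nat.le_mul_of_pos_right _ hpos) (le_of_eq (by ring))
      _ = D.card * ((d + 1) * b ^ (2 * m * (d + 1))) := by rw [← hcard]; ring
  refine (Set.encard_le_encard hY).trans ?_
  rw [Set.encard_coe_eq_coe_finsetCard]
  exact_mod_cast hYcard

theorem encard_chase_le_of_isWeaklyAcyclic (D : Finset (Atom S C)) (Γ : Finset (TGD S V))
    (hΓ : ∀ σ ∈ Γ, σ.IsGuarded)
    (hvars : ∀ σ ∈ Γ, ∀ σ' ∈ Γ, σ ≠ σ' → Disjoint σ.vars σ'.vars)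
    (hwa : IsWeaklyAcyclic (simpleDB (linDB (D : Set (Atom S C)) (Γ : Set (TGD S V))))
      (simpleTGDs (linTGDs (Γ : Set (TGD S V))))) :
    (chase (D : Set (Atom S C)) (Γ : Set (TGD S V))).encard ≤
      ((D.card * fG (Γ : Set (TGD S V)) : ℕ) : ℕ∞) := by
  rcases Γ.eq_empty_or_nonempty with rfl | hne
  · have h1 : fG ((∅ : Finset (TGD S V)) : Set (TGD S V)) = 1 := by
      simp [fG, sizeBound, depthBound, sch, atomsOf, ar]
    rw [h1, mul_one, Finset.coe_empty, chase_empty]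
    refine (Set.encard_image_le _ _).trans ?_
    rw [Set.encard_coe_eq_coe_finsetCard]
  · obtain ⟨hfin, hcard⟩ := ncard_realizedNodes_le (D := (D : Set (Atom S C))) Γ.finite_toSet hne
    exact encard_chase_le_of_depthLe D Γ hΓ hvars hne rfl rfl rfl fun γ hγ hP t ht =>
      depthLe_of_isWeaklyAcyclic hΓ hwa hfin hcard hγ hP ht

end Counting

/-! ### Growth of the bound -/

section Growth

/-- The exponent in `sizeBound a n m ≤ (a + 2) ^ 2 ^ growthExponent n m`. -/
def growthExponent (n m : ℕ) : ℕ :=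
  (n + m * (2 * m + 1) + n * m ^ m + 1) + 2 * m * (1 + n * m)

theorem sizeBound_le_pow_growthExponent (a n m : ℕ) :
    sizeBound a n m ≤ (a + 2) ^ 2 ^ growthExponent n m := by
  have hlt : ∀ k : ℕ, k ≤ 2 ^ k := fun k => Nat.lt_two_pow_self.le
  have h2 : ∀ k : ℕ, 2 ^ k ≤ (a + 2) ^ k := fun k => Nat.pow_le_pow_left (by omega) k
  set d := depthBound n m with hd
  have hbase : a * n * m ≤ (a + 2) ^ (1 + n * m) := by
    rw [pow_add, pow_one, mul_assoc]
    exact Nat.mul_le_mul (by omega) ((hlt _).trans (h2 _))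
  have hdle : d + 1 ≤ 2 ^ (n + m * (2 * m + 1) + n * m ^ m + 1) := by
    have h1 : d ≤ 2 ^ (n + m * (2 * m + 1) + n * m ^ m) := by
      rw [hd, depthBound, pow_add 2, pow_add 2, pow_mul 2 m]
      exact Nat.mul_le_mul_right _ (Nat.mul_le_mul (hlt _) (Nat.pow_le_pow_left (hlt _) _))
    have h3 : 1 ≤ 2 ^ (n + m * (2 * m + 1) + n * m ^ m) := Nat.one_le_two_pow
    rw [pow_succ]
    omega
  have hexp : (d + 1) * (1 + 2 * m * (1 + n * m)) ≤ 2 ^ growthExponent n m := by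
    rw [growthExponent, pow_add 2 (n + m * (2 * m + 1) + n * m ^ m + 1)]
    refine Nat.mul_le_mul hdle ?_
    rw [add_comm]
    exact Nat.lt_two_pow_self
  calc sizeBound a n m = (d + 1) * (a * n * m) ^ (2 * m * (d + 1)) := rfl
    _ ≤ (a + 2) ^ (d + 1) * ((a + 2) ^ (1 + n * m)) ^ (2 * m * (d + 1)) :=
      Nat.mul_le_mul ((hlt _).trans (h2 _)) (Nat.pow_le_pow_left hbase _)
    _ = (a + 2) ^ ((d + 1) * (1 + 2 * m * (1 + n * m))) := by
      rw [← pow_mul, ← pow_add]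
      congr 1
      ring
    _ ≤ (a + 2) ^ 2 ^ growthExponent n m := Nat.pow_le_pow_right (by omega) hexp

open Polynomial in
theorem exists_polynomial_sizeBound_arity (n : ℕ) : ∃ p : Polynomial ℕ, ∀ a m : ℕ,
    sizeBound a n m ≤ (a + 2) ^ (2 ^ (2 ^ (p.eval m))) := by
  refine ⟨C n + X * (2 * X + 1) + C n + 1 + 2 * X * (1 + C n * X) + X * X, fun a m =>
    (sizeBound_le_pow_growthExponent a n m).trans
      (Nat.pow_le_pow_right (by omega) (Nat.pow_le_pow_right (by omega) ?_))⟩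
  -- the summand `X * X` accounts for `m ^ m ≤ 2 ^ (m * m)`
  simp only [eval_add, eval_mul, eval_C, eval_X, eval_ofNat, eval_one]
  rw [pow_add 2 _ (m * m)]
  set q := n + m * (2 * m + 1) + n + 1 + 2 * m * (1 + n * m) with hq
  have hmm : m ^ m ≤ 2 ^ (m * m) := by
    rw [pow_mul]
    exact Nat.pow_le_pow_left Nat.lt_two_pow_self.le _
  have h1 : 1 ≤ 2 ^ (m * m) := Nat.one_le_two_pow
  refine le_trans ?_ (Nat.mul_le_mul_right _ (Nat.lt_two_pow_self (n := q)).le)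
  calc growthExponent n m
      = (n + m * (2 * m + 1) + 1 + 2 * m * (1 + n * m)) + n * m ^ m := by
        rw [growthExponent]; ring
    _ ≤ (n + m * (2 * m + 1) + 1 + 2 * m * (1 + n * m)) * 2 ^ (m * m) + n * 2 ^ (m * m) :=
        Nat.add_le_add (Nat.le_mul_of_pos_right _ h1) (Nat.mul_le_mul_left _ hmm)
    _ = q * 2 ^ (m * m) := by rw [hq]; ring

open Polynomial in
theorem exists_polynomial_sizeBound_pred (m : ℕ) : ∃ p : Polynomial ℕ, ∀ a n : ℕ,
    sizeBound a n m ≤ (a + 2) ^ (2 ^ (p.eval n)) := by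
  refine ⟨X + C (m * (2 * m + 1)) + X * C (m ^ m) + 1 + C (2 * m) * (1 + X * C m), fun a n =>
    (sizeBound_le_pow_growthExponent a n m).trans (le_of_eq ?_)⟩
  simp only [eval_add, eval_mul, eval_C, eval_X, eval_one]
  rfl

end Growth

end SOChase

theorem mainTheorem1 {S : Signature} {C V : Type*} (D : Finset (Atom S C)) (Γ : Finset (TGD S V))
    (hguarded : ∀ σ ∈ Γ, σ.IsGuarded)
    (hvars : ∀ σ ∈ Γ, ∀ σ' ∈ Γ, σ ≠ σ' → Disjoint σ.vars σ'.vars) :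
    List.TFAE
      [ CTForall (D : Set (Atom S C)) (Γ : Set (TGD S V)),
        CTExists (D : Set (Atom S C)) (Γ : Set (TGD S V)),
        (chase (D : Set (Atom S C)) (Γ : Set (TGD S V))).Finite,
        (chase (D : Set (Atom S C)) (Γ : Set (TGD S V))).encard ≤
          ((D.card * fG (Γ : Set (TGD S V)) : ℕ) : ℕ∞),
        IsWeaklyAcyclic (simpleDB (linDB (D : Set (Atom S C)) (Γ : Set (TGD S V))))
          (simpleTGDs (linTGDs (Γ : Set (TGD S V)))) ] ∧
    (∀ n : ℕ, ∃ p : Polynomial ℕ, ∀ a m : ℕ,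
      sizeBound a n m ≤ (a + 2) ^ (2 ^ (2 ^ (p.eval m)))) ∧
    (∀ m : ℕ, ∃ p : Polynomial ℕ, ∀ a n : ℕ,
      sizeBound a n m ≤ (a + 2) ^ (2 ^ (p.eval n))) := by
  refine ⟨?_, exists_polynomial_sizeBound_arity, exists_polynomial_sizeBound_pred⟩
  tfae_have 1 → 2 := ctExists_of_ctForall D.finite_toSet Γ.finite_toSet
  tfae_have 2 → 3 := finite_chase_of_ctExists D.finite_toSet
  tfae_have 3 → 1 := ctForall_of_finite_chase
  tfae_have 3 → 5 := isWeaklyAcyclic_of_finite_chase hguarded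
  tfae_have 5 → 4 := encard_chase_le_of_isWeaklyAcyclic D Γ hguarded hvars
  tfae_have 4 → 3 := fun h => Set.finite_of_encard_le_coe h
  tfae_finish
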